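/- Let $p$ be a prime number, $\mathbb{F}$ a field of characteristic $0$, and $K$ a finite group. For a finite group $G$ let $\mathbb{F}B(G)=\mathbb{F}\otimes_{\mathbb{Z}}B(G)$, where $B(G)$ is the Burnside group of finite $G$-sets, and put $\mathbb{F}B_K(G)=\mathbb{F}B(G\times K)$. A finite $(H,G)$-biset $U$ acts by $\mathbb{F}B_K(U):\mathbb{F}B_K(G)\to\mathbb{F}B_K(H)$, $[X]\mapsto[(U\times K)\times_{G\times K}X]$, where $K$ acts on both sides of the second factor of $U\times K$ by multiplication. There are bilinear products $\mathbb{F}B_K(G)\times\mathbb{F}B_K(H)\to\mathbb{F}B_K(G\times H)$, sending $([X],[Y])$ to the class of $X\times Y$ with action $(g,h,k)\cdot(x,y)=((g,k)x,(h,k)y)$. This makes $\mathbb{F}B_K$ a Green biset functor; $\mathbb{F}B_K^{(p)}$ denotes its restriction to finite $p$-groups. An ideal $I$ of $\mathbb{F}B_K$ (resp. of $\mathbb{F}B_K^{(p)}$) is a family of subspaces $I(G)\subseteq\mathbb{F}B_K(G)$, for all finite groups (resp. all finite $p$-groups) $G$, stable under all bisets between such groups and under products (on either side) with arbitrary elements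 of $\mathbb{F}B_K(H)$, for all such $H$. Ideals are ordered by inclusion, and sums of ideals are computed at each group. For a finite group $G$ and $L\leq G$, let $e_L^G=\frac{1}{|N_G(L)|}\sum_{X\leq L}|X|\,\mu(X,L)\,[G/X]\in\mathbb{F}B(G)$, where $\mu$ is the Möbius function of the poset of subgroups of $G$. For $N\trianglelefteq L$, let $m_{L,N}=\frac{1}{|L|}\sum_{X\leq L,\;XN=L}|X|\,\mu(X,L)$. A group over $K$ is a pair $(L,\varphi)$ of a finite group $L$ and a homomorphism $\varphi:L\to K$. A morphism $(L,\varphi)\to(L',\varphi')$ is a group homomorphism $f:L\to L'$ such that $\varphi'\circ f=i\circ\varphi$ for some inner automorphism $i$ of $K$; write $(L,\varphi)\twoheadrightarrow(L',\varphi')$ if there is a surjective such $f$. Let $\mathsf{e}_{L,\varphi}$ be the ideal of $\mathbb{F}B_K$ generated by $e^{L\times K}_{L_\varphi}\in\mathbb{F}B_K(L)$, where $L_\varphi=\{(l,\varphi(l))\mid l\in L\}$. Call $(L,\varphi)$ $p$-persistent if $\mathsf{e}_{L,\varphi}(P)\neq\{0\}$ for some finite $p$-group $P$, and call it a $B_K$-group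 if $m_{L,N}=0$ for every non-trivial normal subgroup $N$ of $L$ contained in $\operatorname{Ker}\varphi$. Let $O^p(L)$ be the subgroup of $L$ generated by the elements of order prime to $p$, let $L^{[p]}=L/O^p(L)$, and let $\mathsf{e}^{(p)}_{L,\varphi}$ be the ideal of $\mathbb{F}B_K^{(p)}$ generated by $e^{L^{[p]}\times K}_{L^{(p)}_\varphi}\in\mathbb{F}B_K(L^{[p]})$, where $L^{(p)}_\varphi=\{(lO^p(L),\varphi(l))\mid l\in L\}$. Fix a set $\mathcal{S}_K$ of representatives of the isomorphism classes of groups over $K$, and let $\mathcal{B}$ be the set of $p$-persistent $B_K$-groups in $\mathcal{S}_K$. A subset $\mathcal{P}\subseteq\mathcal{B}$ is closed if, for all $(L,\varphi)\in\mathcal{P}$ and $(M,\psi)\in\mathcal{B}$, $(M,\psi)\twoheadrightarrow(L,\varphi)$ implies $(M,\psi)\in\mathcal{P}$; closed subsets are ordered by inclusion. **Theorem.** The map $$I\mapsto\mathcal{P}_I=\{(L,\varphi)\in\mathcal{B}\mid\mathsf{e}^{(p)}_{L,\varphi}\subseteq I\}$$ is an isomorphism of lattices from the lattice of ideals of $\mathbb{F}B_K^{(p)}$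 to the lattice of closed subsets of $\mathcal{B}$, with inverse $$\mathcal{P}\mapsto\sum_{(L,\varphi)\in\mathcal{P}}\mathsf{e}^{(p)}_{L,\varphi}.$$ In particular the lattice of ideals of $\mathbb{F}B_K^{(p)}$ is completely distributive: arbitrary sums distribute over arbitrary intersections, and arbitrary intersections distribute over arbitrary sums. -/

import Mathlib

open scoped TensorProduct

universe u v w

namespace RelB

noncomputable section

/-! ## Finite sets with a group action and the Burnside group -/

/-- A finite set with a left action of the group `G`. -/
structure FinGSet (G : Type u) [Group G] where
  carrier : Type u
  [act : MulAction G carrier]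
  [fin : Finite carrier]

attribute [instance] FinGSet.act FinGSet.fin

namespace FinGSet

variable {G : Type u} [Group G]

/-- Isomorphism of `G`-sets: a `G`-equivariant bijection. -/
def Iso (X Y : FinGSet G) : Prop :=
  ∃ e : X.carrier ≃ Y.carrier, ∀ (g : G) (x : X.carrier), e (g • x) = g • e x

instance setoid (G : Type u) [Group G] : Setoid (FinGSet G) where
  r := Iso
  iseqv :=
    { refl := fun _ => ⟨Equiv.refl _, fun _ _ => rfl⟩
      symm := by
        rintro X Y ⟨e, he⟩
        refine ⟨e.symm, fun g y => ?_⟩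
        rw [Equiv.symm_apply_eq, he, Equiv.apply_symm_apply]
      trans := by
        rintro X Y Z ⟨e, he⟩ ⟨f, hf⟩
        exact ⟨e.trans f, fun g x => by simp [he, hf]⟩ }

/-- The empty `G`-set. -/
def empty (G : Type u) [Group G] : FinGSet G where
  carrier := PEmpty.{u + 1}
  act := { smul := fun _ x => x, one_smul := nofun, mul_smul := nofun }

/-- The disjoint union of two `G`-sets. -/
def disjUnion (X Y : FinGSet G) : FinGSet G where
  carrier := X.carrier ⊕ Y.carrier

/-- The transitive `G`-set `G / X`. -/
def coset [Finite G] (X : Subgroup G) : FinGSet G where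
  carrier := G ⧸ X

/-- The `(G × H)`-set `X × Y`, for a `G`-set `X` and an `H`-set `Y`. -/
def extProd {H : Type u} [Group H] (X : FinGSet G) (Y : FinGSet H) : FinGSet (G × H) where
  carrier := X.carrier × Y.carrier
  act :=
    { smul := fun g x => (g.1 • x.1, g.2 • x.2)
      one_smul := fun _ => Prod.ext (one_smul _ _) (one_smul _ _)
      mul_smul := fun _ _ _ => Prod.ext (mul_smul _ _ _) (mul_smul _ _ _) }

/-- The `G'`-set obtained from a `G`-set by means of a group homomorphism `G' → G`. -/
def comap {G' : Type u} [Group G'] (f : G' →* G) (X : FinGSet G) : FinGSet G' where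
  carrier := X.carrier
  act := MulAction.compHom X.carrier f

end FinGSet

/-- The commutative monoid of isomorphism classes of finite `G`-sets, under disjoint union. -/
def GSetClass (G : Type u) [Group G] : Type (u + 1) := Quotient (FinGSet.setoid G)

namespace GSetClass

variable {G H : Type u} [Group G] [Group H]

/-- The isomorphism class of a finite `G`-set. -/
def mk (X : FinGSet G) : GSetClass G := Quotient.mk _ X

instance : Zero (GSetClass G) := ⟨mk (FinGSet.empty G)⟩

instance : Add (GSetClass G) :=
  ⟨Quotient.map₂ FinGSet.disjUnion (by
    rintro X X' ⟨e, he⟩ Y Y' ⟨f, hf⟩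
    refine ⟨Equiv.sumCongr e f, ?_⟩
    rintro g (x | y)
    · exact congrArg Sum.inl (he g x)
    · exact congrArg Sum.inr (hf g y))⟩

instance : AddCommMonoid (GSetClass G) where
  add_assoc := by
    rintro ⟨X⟩ ⟨Y⟩ ⟨Z⟩
    refine Quotient.sound ⟨Equiv.sumAssoc _ _ _, ?_⟩
    rintro g ((x | y) | z) <;> rfl
  zero_add := by
    rintro ⟨X⟩
    refine Quotient.sound ⟨Equiv.emptySum PEmpty.{u + 1} _, ?_⟩
    rintro g (x | x)
    · exact x.elim
    · rfl
  add_zero := by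
    rintro ⟨X⟩
    refine Quotient.sound ⟨Equiv.sumEmpty _ PEmpty.{u + 1}, ?_⟩
    rintro g (x | x)
    · rfl
    · exact x.elim
  add_comm := by
    rintro ⟨X⟩ ⟨Y⟩
    refine Quotient.sound ⟨Equiv.sumComm _ _, ?_⟩
    rintro g (x | x) <;> rfl
  nsmul := nsmulRec

/-- Restriction of classes along a group homomorphism. -/
def comap (f : H →* G) : GSetClass G →+ GSetClass H where
  toFun := Quotient.map (FinGSet.comap f) (by
    rintro X Y ⟨e, he⟩
    exact ⟨e, fun g x => he (f g) x⟩)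
  map_zero' := Quotient.sound ⟨Equiv.refl _, fun _ x => x.elim⟩
  map_add' := by
    rintro ⟨X⟩ ⟨Y⟩
    refine Quotient.sound ⟨Equiv.refl _, ?_⟩
    rintro g (x | x) <;> rfl

/-- The product of classes of a `G`-set and of an `H`-set, a biadditive map. -/
def extProd : GSetClass G →+ GSetClass H →+ GSetClass (G × H) where
  toFun a :=
    { toFun := fun b => Quotient.map₂ FinGSet.extProd (by
        rintro X X' ⟨e, he⟩ Y Y' ⟨f, hf⟩
        exact ⟨Equiv.prodCongr e f, fun g x => Prod.ext (he g.1 x.1) (hf g.2 x.2)⟩) a b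
      map_zero' := by
        obtain ⟨X⟩ := a
        exact Quotient.sound ⟨Equiv.prodPEmpty _, fun _ x => x.2.elim⟩
      map_add' := by
        obtain ⟨X⟩ := a
        rintro ⟨Y⟩ ⟨Z⟩
        refine Quotient.sound ⟨Equiv.prodSumDistrib _ _ _, ?_⟩
        rintro g ⟨x, y | y⟩ <;> rfl }
  map_zero' := by
    ext b
    obtain ⟨Y⟩ := b
    exact Quotient.sound ⟨Equiv.pemptyProd _, fun _ x => x.1.elim⟩
  map_add' := by
    rintro ⟨X⟩ ⟨Y⟩
    ext b
    obtain ⟨Z⟩ := b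
    refine Quotient.sound ⟨Equiv.sumProdDistrib _ _ _, ?_⟩
    rintro g ⟨x | x, y⟩ <;> rfl

end GSetClass

/-- The Burnside group `B(G)`: the Grothendieck group of finite `G`-sets. -/
abbrev BurnsideGroup (G : Type u) [Group G] : Type (u + 1) :=
  Algebra.GrothendieckAddGroup (GSetClass G)

/-- The additive map of Burnside groups induced by an additive map of classes of sets. -/
def BurnsideGroup.map {G H : Type u} [Group G] [Group H] (f : GSetClass G →+ GSetClass H) :
    BurnsideGroup G →+ BurnsideGroup H :=
  Algebra.GrothendieckAddGroup.lift (Algebra.GrothendieckAddGroup.of.comp f)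

theorem BurnsideGroup.map_of {G H : Type u} [Group G] [Group H] (f : GSetClass G →+ GSetClass H)
    (x : GSetClass G) :
    BurnsideGroup.map f (Algebra.GrothendieckAddGroup.of x) =
      Algebra.GrothendieckAddGroup.of (f x) :=
  DFunLike.congr_fun (Algebra.GrothendieckAddGroup.lift.symm_apply_apply
    (Algebra.GrothendieckAddGroup.of.comp f)) x

/-- The biadditive product `B(G) × B(H) → B(G × H)`. -/
def BurnsideGroup.extProd {G H : Type u} [Group G] [Group H] :
    BurnsideGroup G →+ BurnsideGroup H →+ BurnsideGroup (G × H) :=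
  Algebra.GrothendieckAddGroup.lift
    { toFun := fun a => BurnsideGroup.map (GSetClass.extProd a)
      map_zero' := by
        refine Algebra.GrothendieckAddGroup.lift.symm.injective ?_
        ext b
        simp [BurnsideGroup.map]
      map_add' := fun a a' => by
        refine Algebra.GrothendieckAddGroup.lift.symm.injective ?_
        ext b
        change BurnsideGroup.map (GSetClass.extProd (a + a')) (.of b) =
          BurnsideGroup.map (GSetClass.extProd a) (.of b) +
            BurnsideGroup.map (GSetClass.extProd a') (.of b)
        simp only [BurnsideGroup.map_of, map_add, AddMonoidHom.add_apply] }

/-- `𝔽B(G) = 𝔽 ⊗ B(G)`. -/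
abbrev FB (F : Type v) [Field F] (G : Type u) [Group G] : Type (max v (u + 1)) :=
  F ⊗[ℤ] BurnsideGroup G

namespace FB

variable (F : Type v) [Field F] {G H : Type u} [Group G] [Group H]

/-- The class `[X] ∈ 𝔽B(G)` of a finite `G`-set `X`. -/
def cls (X : FinGSet G) : FB F G :=
  (1 : F) ⊗ₜ[ℤ] Algebra.GrothendieckAddGroup.of (GSetClass.mk X)

/-- The `𝔽`-linear map `𝔽B(G) → 𝔽B(H)` induced by an additive map of classes of sets. -/
def map (f : GSetClass G →+ GSetClass H) : FB F G →ₗ[F] FB F H :=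
  LinearMap.baseChange F (BurnsideGroup.map f).toIntLinearMap

/-- The `𝔽`-bilinear product `𝔽B(G) × 𝔽B(H) → 𝔽B(G × H)`. -/
def extProd : FB F G →ₗ[F] FB F H →ₗ[F] FB F (G × H) :=
  LinearMap.liftBaseChange F
    (AddMonoidHom.toIntLinearMap
      { toFun := fun b => LinearMap.baseChange F (BurnsideGroup.extProd b).toIntLinearMap
        map_zero' := by
          ext x
          simp
        map_add' := fun b b' => by
          ext x
          simp [TensorProduct.tmul_add] })

end FB

/-! ## Bisets -/

/-- A finite `(H, G)`-biset: `H` acts on the left, `G` acts on the right, and the actions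
commute. -/
structure Biset (H G : Type u) [Group H] [Group G] where
  carrier : Type u
  [left : MulAction H carrier]
  [right : MulAction Gᵐᵒᵖ carrier]
  [comm : SMulCommClass H Gᵐᵒᵖ carrier]
  [fin : Finite carrier]

attribute [instance] Biset.left Biset.right Biset.comm Biset.fin

namespace Biset

variable {G H : Type u} [Group G] [Group H]

/-- The equivalence relation on `U × X` whose classes are the orbits of `G` acting by
`(u, x) · g = (u g, g⁻¹ x)`. -/
def orbitSetoid (U : Biset H G) (X : FinGSet G) : Setoid (U.carrier × X.carrier) where
  r a b := ∃ g : G, b = (MulOpposite.op g • a.1, g⁻¹ • a.2)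
  iseqv :=
    { refl := fun a => ⟨1, by simp⟩
      symm := by
        rintro a b ⟨g, rfl⟩
        exact ⟨g⁻¹, by simp⟩
      trans := by
        rintro a b c ⟨g, rfl⟩ ⟨h, rfl⟩
        exact ⟨g * h, by simp [mul_smul]⟩ }

/-- The `H`-set `U ×_G X`, for an `(H, G)`-biset `U` and a `G`-set `X`. -/
def compSet (U : Biset H G) (X : FinGSet G) : FinGSet H where
  carrier := Quotient (U.orbitSetoid X)
  act :=
    { smul := fun h => Quotient.map (fun a => (h • a.1, a.2)) (by
        rintro a b ⟨g, rfl⟩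
        exact ⟨g, Prod.ext (smul_comm _ _ _) rfl⟩)
      one_smul := by
        rintro ⟨a⟩
        exact congrArg (Quotient.mk _) (Prod.ext (one_smul _ _) rfl)
      mul_smul := by
        rintro h h' ⟨a⟩
        exact congrArg (Quotient.mk _) (Prod.ext (mul_smul _ _ _) rfl) }
  fin := Quotient.finite _

/-- The map `X ↦ U ×_G X` on isomorphism classes. -/
def compClass (U : Biset H G) : GSetClass G →+ GSetClass H where
  toFun := Quotient.map U.compSet (by
    rintro X Y ⟨e, he⟩
    refine ⟨Quotient.congr (Equiv.prodCongr (Equiv.refl _) e) ?_, ?_⟩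
    · rintro ⟨u, x⟩ ⟨u', x'⟩
      refine exists_congr fun g => ?_
      simp only [Prod.ext_iff, Equiv.prodCongr_apply, Prod.map, Equiv.refl_apply, ← he,
        e.apply_eq_iff_eq]
    · rintro h ⟨a⟩
      rfl)
  map_zero' := by
    refine Quotient.sound ⟨?_, ?_⟩
    · refine @Equiv.equivPEmpty _ ⟨?_⟩
      rintro ⟨a⟩
      exact a.2.elim
    · rintro h ⟨a⟩
      exact a.2.elim
  map_add' := by
    rintro ⟨X⟩ ⟨Y⟩
    refine Quotient.sound ⟨?_, ?_⟩
    · refine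
        { toFun := Quotient.lift (fun a => Sum.elim
            (fun x => Sum.inl (Quotient.mk (U.orbitSetoid X) (a.1, x)))
            (fun y => Sum.inr (Quotient.mk (U.orbitSetoid Y) (a.1, y))) a.2) ?_
          invFun := Sum.elim
            (Quotient.map (fun a => (a.1, Sum.inl a.2)) ?_)
            (Quotient.map (fun a => (a.1, Sum.inr a.2)) ?_)
          left_inv := ?_
          right_inv := ?_ }
      · rintro ⟨u, x | y⟩ b ⟨g, rfl⟩
        · exact congrArg Sum.inl (Quotient.sound ⟨g, rfl⟩)
        · exact congrArg Sum.inr (Quotient.sound ⟨g, rfl⟩)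
      · rintro a b ⟨g, rfl⟩
        exact ⟨g, rfl⟩
      · rintro a b ⟨g, rfl⟩
        exact ⟨g, rfl⟩
      · rintro ⟨u, x | y⟩ <;> rfl
      · rintro (a | a) <;> induction a using Quotient.inductionOn <;> rfl
    · rintro h ⟨u, x | y⟩ <;> rfl

/-- The `(H × K, G × K)`-biset `U × K`, with `K` acting on both sides on the second component by
multiplication. -/
def shift (K : Type u) [Group K] [Finite K] (U : Biset H G) : Biset (H × K) (G × K) :=
  letI left : MulAction (H × K) (U.carrier × K) :=
    { smul := fun a x => (a.1 • x.1, a.2 * x.2)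
      one_smul := fun _ => Prod.ext (one_smul _ _) (one_mul _)
      mul_smul := fun _ _ _ => Prod.ext (mul_smul _ _ _) (mul_assoc _ _ _) }
  letI right : MulAction (G × K)ᵐᵒᵖ (U.carrier × K) :=
    { smul := fun a x => (MulOpposite.op a.unop.1 • x.1, x.2 * a.unop.2)
      one_smul := fun _ => Prod.ext (one_smul _ _) (mul_one _)
      mul_smul := fun a b x =>
        Prod.ext (mul_smul (MulOpposite.op a.unop.1) (MulOpposite.op b.unop.1) x.1)
          (mul_assoc _ _ _).symm }
  { carrier := U.carrier × K
    left := left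
    right := right
    comm := ⟨fun _ _ x => Prod.ext (smul_comm _ _ x.1) (mul_assoc _ _ _).symm⟩ }

end Biset

/-! ## The shifted Burnside functor and its ideals -/

section Shifted

variable (F : Type v) [Field F] (K : Type u) [Group K] [Finite K]

/-- The evaluation `𝔽B_K(G) = 𝔽B(G × K)`. -/
abbrev FBK (G : Type u) [Group G] : Type (max v (u + 1)) := FB F (G × K)

/-- The map `𝔽B_K(U) : 𝔽B_K(G) → 𝔽B_K(H)` attached to a finite `(H, G)`-biset `U`. -/
def FBK.ofBiset {G H : Type u} [Group G] [Group H] (U : Biset H G) : FBK F K G →ₗ[F] FBK F K H :=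
  FB.map F (U.shift K).compClass

/-- The homomorphism `(g, h, k) ↦ (g, k, h, k)`. -/
def diagHom (G H : Type u) [Group G] [Group H] : (G × H) × K →* (G × K) × (H × K) where
  toFun x := ((x.1.1, x.2), (x.1.2, x.2))
  map_one' := rfl
  map_mul' _ _ := rfl

/-- The product `𝔽B_K(G) × 𝔽B_K(H) → 𝔽B_K(G × H)` of the Green biset functor `𝔽B_K`. -/
def FBK.prod {G H : Type u} [Group G] [Group H] :
    FBK F K G →ₗ[F] FBK F K H →ₗ[F] FBK F K (G × H) :=
  (FB.extProd F).compr₂ (FB.map F (GSetClass.comap (diagHom K G H)))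

end Shifted

/-- A class of finite groups closed under direct products. -/
structure GroupClass where
  Mem : ∀ (G : Type u) [Group G], Prop
  prod_mem : ∀ (G H : Type u) [Group G] [Group H], Mem G → Mem H → Mem (G × H)

/-- The class of all (finite) groups. -/
def GroupClass.all : GroupClass.{u} where
  Mem _ _ := True
  prod_mem _ _ _ _ _ _ := trivial

/-- The class of (finite) `p`-groups. -/
def GroupClass.pGroups (p : ℕ) : GroupClass.{u} where
  Mem G _ := IsPGroup p G
  prod_mem G H _ _ hG hH := by
    rintro ⟨g, h⟩
    obtain ⟨a, ha⟩ := hG g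
    obtain ⟨b, hb⟩ := hH h
    refine ⟨a + b, Prod.ext ?_ ?_⟩
    · simp [pow_add, pow_mul, ha]
    · simp [pow_add, pow_mul', hb]

/-- An ideal of the restriction of the Green biset functor `𝔽B_K` to the finite groups in the
class `D`: a biset subfunctor stable under products with arbitrary elements of `𝔽B_K`. Stability
under `𝔽`-linear combinations of bisets follows from stability under bisets. -/
@[ext]
structure GreenIdeal (F : Type v) [Field F] (K : Type u) [Group K] [Finite K]
    (D : GroupClass.{u}) where
  eval : ∀ (G : Type u) [Group G] [Finite G], D.Mem G → Submodule F (FBK F K G)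
  biset_mem : ∀ {G H : Type u} [Group G] [Finite G] [Group H] [Finite H] (hG : D.Mem G)
    (hH : D.Mem H) (U : Biset H G) (a : FBK F K G), a ∈ eval G hG →
      FBK.ofBiset F K U a ∈ eval H hH
  prod_mem_left : ∀ {G H : Type u} [Group G] [Finite G] [Group H] [Finite H] (hG : D.Mem G)
    (hH : D.Mem H) (a : FBK F K G) (b : FBK F K H), b ∈ eval H hH →
      FBK.prod F K a b ∈ eval (G × H) (D.prod_mem G H hG hH)
  prod_mem_right : ∀ {G H : Type u} [Group G] [Finite G] [Group H] [Finite H] (hG : D.Mem G)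
    (hH : D.Mem H) (a : FBK F K G) (b : FBK F K H), a ∈ eval G hG →
      FBK.prod F K a b ∈ eval (G × H) (D.prod_mem G H hG hH)

namespace GreenIdeal

variable {F : Type v} [Field F] {K : Type u} [Group K] [Finite K] {D : GroupClass.{u}}

/-- Ideals are ordered by inclusion of all evaluations. -/
instance : PartialOrder (GreenIdeal F K D) where
  le I J := ∀ (G : Type u) [Group G] [Finite G] (hG : D.Mem G), I.eval G hG ≤ J.eval G hG
  le_refl _ _ _ _ _ := le_rfl
  le_trans _ _ _ hIJ hJL G _ _ hG := (hIJ G hG).trans (hJL G hG)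
  le_antisymm I J hIJ hJI := by
    ext G _ _ hG : 5
    exact le_antisymm (hIJ G hG) (hJI G hG)

/-- The sum of a set of ideals, computed at each group. -/
instance : SupSet (GreenIdeal F K D) where
  sSup A :=
    { eval := fun G _ _ hG => ⨆ I : A, I.1.eval G hG
      biset_mem := fun {G H} _ _ _ _ hG hH U a ha => by
        have h : (⨆ I : A, I.1.eval G hG) ≤
            (⨆ I : A, I.1.eval H hH).comap (FBK.ofBiset F K U) :=
          iSup_le fun I x hx => (le_iSup (fun I : A => I.1.eval H hH) I)
            (I.1.biset_mem hG hH U x hx)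
        exact h ha
      prod_mem_left := fun {G H} _ _ _ _ hG hH a b hb => by
        have h : (⨆ I : A, I.1.eval H hH) ≤
            (⨆ I : A, I.1.eval (G × H) (D.prod_mem G H hG hH)).comap (FBK.prod F K a) :=
          iSup_le fun I x hx => (le_iSup (fun I : A => I.1.eval (G × H) _) I)
            (I.1.prod_mem_left hG hH a x hx)
        exact h hb
      prod_mem_right := fun {G H} _ _ _ _ hG hH a b ha => by
        have h : (⨆ I : A, I.1.eval G hG) ≤
            (⨆ I : A, I.1.eval (G × H) (D.prod_mem G H hG hH)).comap
              ((FBK.prod F K (G := G) (H := H)).flip b) :=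
          iSup_le fun I x hx => (le_iSup (fun I : A => I.1.eval (G × H) _) I)
            (I.1.prod_mem_right hG hH x b hx)
        exact h ha }

/-- The intersection of a set of ideals. -/
instance : InfSet (GreenIdeal F K D) where
  sInf A :=
    { eval := fun G _ _ hG => ⨅ I : A, I.1.eval G hG
      biset_mem := fun hG hH U a ha => by
        rw [Submodule.mem_iInf] at ha ⊢
        exact fun I => I.1.biset_mem hG hH U a (ha I)
      prod_mem_left := fun hG hH a b hb => by
        rw [Submodule.mem_iInf] at hb ⊢
        exact fun I => I.1.prod_mem_left hG hH a b (hb I)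
      prod_mem_right := fun hG hH a b ha => by
        rw [Submodule.mem_iInf] at ha ⊢
        exact fun I => I.1.prod_mem_right hG hH a b (ha I) }

/-- The lattice of ideals: joins are sums and meets are intersections. -/
instance : CompleteLattice (GreenIdeal F K D) where
  sup I J := sSup {I, J}
  le_sup_left I J G _ _ hG :=
    le_iSup (fun L : ({I, J} : Set (GreenIdeal F K D)) => L.1.eval G hG) ⟨I, Or.inl rfl⟩
  le_sup_right I J G _ _ hG :=
    le_iSup (fun L : ({I, J} : Set (GreenIdeal F K D)) => L.1.eval G hG) ⟨J, Or.inr rfl⟩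
  sup_le I J L hI hJ G _ _ hG := by
    refine iSup_le ?_
    rintro ⟨M, rfl | rfl⟩
    · exact hI G hG
    · exact hJ G hG
  inf I J := sInf {I, J}
  inf_le_left I J G _ _ hG :=
    iInf_le (fun L : ({I, J} : Set (GreenIdeal F K D)) => L.1.eval G hG) ⟨I, Or.inl rfl⟩
  inf_le_right I J G _ _ hG :=
    iInf_le (fun L : ({I, J} : Set (GreenIdeal F K D)) => L.1.eval G hG) ⟨J, Or.inr rfl⟩
  le_inf L I J hI hJ G _ _ hG := by
    refine le_iInf ?_
    rintro ⟨M, rfl | rfl⟩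
    · exact hI G hG
    · exact hJ G hG
  isLUB_sSup A := by
    constructor
    · intro I hI G _ _ hG
      exact le_iSup (fun L : A => L.1.eval G hG) ⟨I, hI⟩
    · intro J hJ G _ _ hG
      exact iSup_le fun L => hJ L.2 G hG
  isGLB_sInf A := by
    constructor
    · intro I hI G _ _ hG
      exact iInf_le (fun L : A => L.1.eval G hG) ⟨I, hI⟩
    · intro J hJ G _ _ hG
      exact le_iInf fun L => hJ L.2 G hG
  top := sInf ∅
  le_top I G _ _ hG := le_iInf fun L => L.2.elim
  bot := sSup ∅
  bot_le I G _ _ hG := iSup_le fun L => L.2.elim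

/-- The ideal generated by an element `a ∈ 𝔽B_K(G)`. -/
def generatedBy {G : Type u} [Group G] [Finite G] (hG : D.Mem G) (a : FBK F K G) :
    GreenIdeal F K D :=
  sInf {I | a ∈ I.eval G hG}

end GreenIdeal

/-! ## Idempotents -/

open Classical in
/-- The Möbius function of the poset of subgroups of a finite group. -/
def moebius {G : Type u} [Group G] [Finite G] (X Y : Subgroup G) : ℤ :=
  letI : Fintype (Subgroup G) := Fintype.ofFinite _
  letI : LocallyFiniteOrder (Subgroup G) := Fintype.toLocallyFiniteOrder
  IncidenceAlgebra.mu ℤ X Y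

/-- The primitive idempotent `e_L^G` of the Burnside algebra `𝔽B(G)`, given by the formula
`|N_G(L)|⁻¹ ∑_{X ≤ L} |X| μ(X, L) [G / X]`. -/
def idem (F : Type v) [Field F] {G : Type u} [Group G] [Finite G] (L : Subgroup G) : FB F G :=
  (Nat.card (Subgroup.normalizer (L : Set G)) : F)⁻¹ •
    ∑ᶠ X : {X : Subgroup G // X ≤ L},
      ((Nat.card X.1 : F) * (moebius X.1 L : F)) • FB.cls F (FinGSet.coset X.1)

/-- The rational number `m_{L,N} = |L|⁻¹ ∑_{X ≤ L, XN = L} |X| μ(X, L)`, for `N` normal in `L`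
(so that `XN` is the join of `X` and `N`). -/
def mConst {L : Type u} [Group L] [Finite L] (N : Subgroup L) : ℚ :=
  (Nat.card L : ℚ)⁻¹ *
    ∑ᶠ X : {X : Subgroup L // X ⊔ N = ⊤}, (Nat.card X.1 : ℚ) * (moebius X.1 ⊤ : ℚ)

/-- The subgroup `O^p(L)` generated by the elements of order prime to `p`. -/
def Op (p : ℕ) (L : Type u) [Group L] : Subgroup L :=
  Subgroup.closure {x | p.Coprime (orderOf x)}

instance Op.normal (p : ℕ) (L : Type u) [Group L] : (Op p L).Normal := by
  refine ⟨fun x hx g => ?_⟩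
  induction hx using Subgroup.closure_induction with
  | mem x hx =>
    refine Subgroup.subset_closure ?_
    have h : orderOf (g * x * g⁻¹) = orderOf x := (MulAut.conj g).orderOf_eq x
    simpa [h] using hx
  | one => simp
  | mul x y _ _ hx hy =>
    have h : g * (x * y) * g⁻¹ = g * x * g⁻¹ * (g * y * g⁻¹) := by group
    exact h ▸ mul_mem hx hy
  | inv x _ hx =>
    have h : g * x⁻¹ * g⁻¹ = (g * x * g⁻¹)⁻¹ := by group
    exact h ▸ inv_mem hx

theorem Op.isPGroup_quotient (p : ℕ) [hp : Fact p.Prime] (L : Type u) [Group L] [Finite L] :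
    IsPGroup p (L ⧸ Op p L) := by
  rintro ⟨x⟩
  obtain ⟨k, m, hm, h⟩ := Nat.exists_eq_pow_mul_and_not_dvd (orderOf_pos x).ne' p hp.out.ne_one
  refine ⟨k, (QuotientGroup.eq_one_iff (x ^ p ^ k)).2 (Subgroup.subset_closure ?_)⟩
  have h1 : orderOf (x ^ p ^ k) = m := by
    rw [orderOf_pow_of_dvd (pow_ne_zero _ hp.out.ne_zero) (h ▸ dvd_mul_right _ _), h,
      Nat.mul_div_cancel_left _ (pow_pos hp.out.pos _)]
  simpa [h1] using (Nat.Prime.coprime_iff_not_dvd hp.out).2 hm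

/-! ## Groups over `K` -/

/-- A finite group over `K`: a finite group `L` with a homomorphism `φ : L → K`. -/
structure GrpOver (K : Type u) [Group K] where
  L : Type u
  [grp : Group L]
  [fin : Finite L]
  φ : L →* K

attribute [instance] GrpOver.grp GrpOver.fin

namespace GrpOver

variable {K : Type u} [Group K]

/-- Morphisms of groups over `K`: homomorphisms compatible with the maps to `K` up to an inner
automorphism of `K`. -/
def Hom (X Y : GrpOver K) : Type u :=
  {f : X.L →* Y.L // ∃ k : K, ∀ l : X.L, k * X.φ l * k⁻¹ = Y.φ (f l)}

instance : CategoryTheory.Category (GrpOver K) where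
  Hom := Hom
  id X := ⟨MonoidHom.id X.L, 1, by simp⟩
  comp f g := ⟨g.1.comp f.1, by
    obtain ⟨f, k, hk⟩ := f
    obtain ⟨g, k', hk'⟩ := g
    refine ⟨k' * k, fun l => ?_⟩
    simp only [MonoidHom.comp_apply, ← hk', ← hk, mul_inv_rev, mul_assoc]⟩

/-- `Y` is a quotient of `X`. -/
def SurjectsOnto (X Y : GrpOver K) : Prop :=
  ∃ f : Hom X Y, Function.Surjective f.1

/-- `(L, φ)` is a `B_K`-group. -/
def IsBKGroup (X : GrpOver K) : Prop :=
  ∀ N : Subgroup X.L, N.Normal → N ≠ ⊥ → N ≤ X.φ.ker → mConst N = 0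

/-- The subgroup `L_φ = {(l, φ(l))}` of `L × K`. -/
def graph (X : GrpOver K) : Subgroup (X.L × K) := ((MonoidHom.id X.L).prod X.φ).range

/-- The subgroup `L_φ^{(p)} = {(l O^p(L), φ(l))}` of `L^{[p]} × K`, with
`L^{[p]} = L / O^p(L)`. -/
def graphP (p : ℕ) (X : GrpOver K) : Subgroup ((X.L ⧸ Op p X.L) × K) :=
  ((QuotientGroup.mk' (Op p X.L)).prod X.φ).range

variable [Finite K] (F : Type v) [Field F]

/-- The ideal `e_{L,φ}` of `𝔽B_K`, generated by the idempotent of `L_φ` in `𝔽B_K(L)`. -/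
def ideal (X : GrpOver K) : GreenIdeal F K GroupClass.all.{u} :=
  GreenIdeal.generatedBy (G := X.L) trivial (idem F X.graph)

/-- `(L, φ)` is `p`-persistent: `e_{L,φ}` does not vanish at some finite `p`-group. -/
def IsPersistent (p : ℕ) (X : GrpOver K) : Prop :=
  ∃ (P : Type u) (_ : Group P) (_ : Finite P), IsPGroup p P ∧ (X.ideal F).eval P trivial ≠ ⊥

/-- The ideal `e_{L,φ}^{(p)}` of the restriction of `𝔽B_K` to finite `p`-groups, generated by the
idempotent of `L_φ^{(p)}` in `𝔽B_K(L^{[p]})`. -/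
def idealP (p : ℕ) [Fact p.Prime] (X : GrpOver K) : GreenIdeal F K (GroupClass.pGroups.{u} p) :=
  GreenIdeal.generatedBy (G := X.L ⧸ Op p X.L) (Op.isPGroup_quotient p X.L) (idem F (X.graphP p))

end GrpOver

/-- `S` is a set of representatives of the isomorphism classes of groups over `K`. -/
def IsRepresentatives {K : Type u} [Group K] (S : Set (GrpOver K)) : Prop :=
  ∀ X : GrpOver K, ∃! Y : GrpOver K, Y ∈ S ∧ Nonempty (X ≅ Y)

section Closed

variable (F : Type v) [Field F] {K : Type u} [Group K] [Finite K]

/-- The `p`-persistent `B_K`-groups in `S`. -/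
def persistentBK (p : ℕ) (S : Set (GrpOver K)) : Set (GrpOver K) :=
  {X | X ∈ S ∧ X.IsBKGroup ∧ X.IsPersistent F p}

/-- A set `P` of `p`-persistent `B_K`-groups is closed if it contains every `p`-persistent
`B_K`-group (in `S`) having a quotient in `P`. -/
def IsClosedSet (p : ℕ) (S : Set (GrpOver K)) (P : Set (persistentBK F p S)) : Prop :=
  ∀ X ∈ P, ∀ Y : persistentBK F p S, Y.1.SurjectsOnto X.1 → Y ∈ P

/-- The complete lattice of closed sets of `p`-persistent `B_K`-groups, ordered by inclusion. -/
def closedSets (p : ℕ) (S : Set (GrpOver K)) : CompleteSublattice (Set (persistentBK F p S)) :=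
  CompleteSublattice.mk' {P | IsClosedSet F p S P}
    (fun A hA X hX Y hY => by
      obtain ⟨P, hP, hXP⟩ := hX
      exact ⟨P, hP, hA hP X hXP Y hY⟩)
    (fun A hA X hX Y hY P hP => hA hP X (hX P hP) Y hY)

end Closed

end

end RelB

open RelB

namespace RelB

noncomputable section

open scoped Classical

attribute [local instance] Fintype.ofFinite

/-! ## Möbius inversion on the poset of subgroups -/

section Moebius

variable {G : Type u} [Group G] [Finite G]

/-! An element of `𝔽B(G × K)` is determined by its marks (fixed-point counts), and it is a
combination of the elements `idemNum F L`, where the mark of `idemNum F L` is nonzero exactly at the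
conjugates of `L`. Products followed by restriction along the diagonal make `I(G)` stable under
multiplication of marks, so `I(G)` is spanned by the `idemNum F L` it contains. An ideal is
therefore a collection of subgroups `L ≤ G × K`, and for a `p`-group `G` membership depends only on
the group over `K` that `L` defines: it amounts to `idealP ≤ I` (`GrpOver.idemNum_mem_iff`).

The constants `m_{L,N}` enter through a formula for the marks of `V ×_G X`
(`card_mul_mark_compClass`). Each `v ∈ V` contributes Möbius transforms which, when nonzero, equal
`|N| m_{L,N}`, with `N` the stabilizer of `v` in `L`. This is used in two directions.

Reduction: if `m_{L,N} ≠ 0` with `N ≤ Ker φ`, the quotient by `N` generates the same ideal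
(`GrpOver.idealP_quotient`). Repeated passage to quotients ends at a `B_K`-group. Persistence of a
`B_K`-group means `O^p(L) ∩ Ker φ = 1` (`GrpOver.isPersistent_iff`); this holds for every subgroup
of `P × K` with `P` a `p`-group and passes to quotients. So an ideal is determined by the members of
`𝓑` whose ideals it contains.

Separation: for a set of `B_K`-groups, the elements supported on subgroups having a quotient in that
set form an ideal (`surjIdeal`). For stability under bisets, a nonzero contribution forces `m_{L,N}
≠ 0`, and then `exists_supplement_of_mSum_ne_zero` shows that every `B_K`-quotient of `L` is already
a quotient of `L / N`, hence of the subgroup at which the mark is taken. Consequently an ideal lying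
in a sum of the ideals of members of `P` comes from a group surjecting onto some member of `P`,
which makes the two maps inverse. Distributivity is inherited from the power set. -/

theorem moebius_eq_zero {X Y : Subgroup G} (h : ¬ X ≤ Y) : moebius X Y = 0 := by
  unfold moebius
  exact IncidenceAlgebra.apply_eq_zero_of_not_le h _

theorem sum_moebius_left (T L : Subgroup G) :
    ∑ Z : Subgroup G, (if T ≤ Z then moebius Z L else 0) = if T = L then 1 else 0 := by
  let _ : LocallyFiniteOrder (Subgroup G) := Fintype.toLocallyFiniteOrder
  have h := IncidenceAlgebra.sum_Icc_mu_left (𝕜 := ℤ) T L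
  rw [← h, ← Finset.sum_filter]
  symm
  refine Finset.sum_subset_zero_on_sdiff ?_ ?_ ?_
  · intro Z hZ
    simpa using (Finset.mem_Icc.1 hZ).1
  · intro Z hZ
    simp only [Finset.mem_sdiff, Finset.mem_filter, Finset.mem_univ, true_and, Finset.mem_Icc,
      not_and] at hZ
    exact moebius_eq_zero (hZ.2 hZ.1)
  · intro Z _
    rfl

theorem sum_moebius_right (S X : Subgroup G) :
    ∑ T : Subgroup G, (if T ≤ X then moebius S T else 0) = if S = X then 1 else 0 := by
  let _ : LocallyFiniteOrder (Subgroup G) := Fintype.toLocallyFiniteOrder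
  have h := IncidenceAlgebra.sum_Icc_mu_right (𝕜 := ℤ) S X
  rw [← h, ← Finset.sum_filter]
  symm
  refine Finset.sum_subset_zero_on_sdiff ?_ ?_ ?_
  · intro Z hZ
    simpa using (Finset.mem_Icc.1 hZ).2
  · intro Z hZ
    simp only [Finset.mem_sdiff, Finset.mem_filter, Finset.mem_univ, true_and, Finset.mem_Icc,
      not_and] at hZ
    exact moebius_eq_zero (fun h => hZ.2 h hZ.1)
  · intro Z _
    rfl

variable {V V' : Type*} [AddCommGroup V] [AddCommGroup V']

/-- The Möbius transform `L ↦ ∑_Z μ(Z, L) n(Z)` of a function `n` on subgroups. -/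
def mob (n : Subgroup G → V) (L : Subgroup G) : V := ∑ Z : Subgroup G, moebius Z L • n Z

theorem mob_comp (f : V →+ V') (n : Subgroup G → V) (L : Subgroup G) :
    f (mob n L) = mob (fun Z => f (n Z)) L := by
  simp [mob, map_sum, map_zsmul]

theorem mob_sum {ι : Type*} (s : Finset ι) (n : ι → Subgroup G → V) (L : Subgroup G) :
    mob (fun Z => ∑ i ∈ s, n i Z) L = ∑ i ∈ s, mob (n i) L := by
  simp only [mob, Finset.smul_sum]
  exact Finset.sum_comm

/-- Möbius inversion. -/
theorem sum_mob (n : Subgroup G → V) (X : Subgroup G) :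
    ∑ T : Subgroup G, (if T ≤ X then mob n T else 0) = n X := by
  have h : ∀ T : Subgroup G, (if T ≤ X then mob n T else 0) =
      ∑ S : Subgroup G, (if T ≤ X then moebius S T else 0) • n S := by
    intro T
    split_ifs <;> simp [mob]
  simp_rw [h]
  rw [Finset.sum_comm]
  simp_rw [← Finset.sum_smul, sum_moebius_right]
  simp [ite_smul]

/-- By Möbius inversion these indicators generate all functions of subgroups, and their transforms
are point masses. Later identities between transforms are checked on them only. -/
theorem mob_indicator (T L : Subgroup G) (a : V) :
    mob (fun Z => if T ≤ Z then a else 0) L = if T = L then a else 0 := by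
  have h : ∀ Z : Subgroup G, moebius Z L • (if T ≤ Z then a else 0) =
      (if T ≤ Z then moebius Z L else 0) • a := by
    intro Z
    split_ifs <;> simp
  simp_rw [mob, h, ← Finset.sum_smul, sum_moebius_left]
  split_ifs <;> simp

/-- Two additive functionals on functions of subgroups agree as soon as they agree on the
indicator functions of the sets `{Z | T ≤ Z}`. -/
theorem addHom_ext_indicator {A B : (Subgroup G → V) →+ V'}
    (h : ∀ (T : Subgroup G) (a : V),
      A (fun Z => if T ≤ Z then a else 0) = B (fun Z => if T ≤ Z then a else 0))
    (n : Subgroup G → V) : A n = B n := by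
  have hn : n = ∑ T : Subgroup G, fun Z => if T ≤ Z then mob n T else 0 := by
    funext Z
    rw [Finset.sum_apply, sum_mob]
  rw [hn, map_sum, map_sum]
  exact Finset.sum_congr rfl fun T _ => h T _

theorem mob_congr {n n' : Subgroup G → V} {L : Subgroup G} (h : ∀ Z ≤ L, n Z = n' Z) :
    mob n L = mob n' L := by
  refine Finset.sum_congr rfl fun Z _ => ?_
  by_cases hZ : Z ≤ L
  · rw [h Z hZ]
  · simp [moebius_eq_zero hZ]

/-- Inverting at `Z ⊓ Q` writes `n` as a combination of indicators of `{Z | T ≤ Z}` with `T ≤ Q`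
only, and each has its transform supported at `T`. -/
theorem mob_eq_zero_of_inf {n : Subgroup G → V} (Q : Subgroup G) (h : ∀ Z, n Z = n (Z ⊓ Q))
    {L : Subgroup G} (hL : ¬ L ≤ Q) : mob n L = 0 := by
  have hn : n = fun Z => ∑ T : Subgroup G, if T ≤ Z then (if T ≤ Q then mob n T else 0) else 0 := by
    funext Z
    rw [h Z, ← sum_mob n (Z ⊓ Q)]
    refine Finset.sum_congr rfl fun T _ => ?_
    by_cases h1 : T ≤ Z <;> by_cases h2 : T ≤ Q <;> simp [h1, h2]
  rw [hn, mob_sum]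
  refine Finset.sum_eq_zero fun T _ => ?_
  rw [mob_indicator]
  split_ifs with h1 h2
  · exact absurd (h1 ▸ h2) hL
  · rfl
  · rfl

/-- The Möbius transform as an additive map. -/
def mobHom (L : Subgroup G) : (Subgroup G → V) →+ V where
  toFun n := mob n L
  map_zero' := by simp [mob]
  map_add' n n' := by simp [mob, Finset.sum_add_distrib]

theorem mob_range {G' : Type u} [Group G'] [Finite G'] (j : G' →* G) (hj : Function.Injective j)
    (n : Subgroup G → V) : mob n j.range = mob (fun Z => n (Z.map j)) ⊤ := by
  refine addHom_ext_indicator (A := mobHom j.range)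
    (B := (mobHom ⊤).comp (AddMonoidHom.compLeft (AddMonoidHom.id V) _ |>.comp
      { toFun := fun m Z => m (Subgroup.map j Z), map_zero' := rfl, map_add' := fun _ _ => rfl }))
    ?_ n
  intro T a
  change mob (fun Z => if T ≤ Z then a else 0) j.range =
    mob (fun Z => if T ≤ Z.map j then a else 0) ⊤
  rw [mob_indicator]
  by_cases hT : T ≤ j.range
  · obtain ⟨T, rfl⟩ : ∃ T' : Subgroup G', T = T'.map j :=
      ⟨T.comap j, (Subgroup.map_comap_eq_self hT).symm⟩
    simp_rw [Subgroup.map_le_map_iff_of_injective hj]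
    rw [mob_indicator, MonoidHom.range_eq_map]
    simp only [(Subgroup.map_injective hj).eq_iff]
  · rw [if_neg (fun h => hT h.le)]
    symm
    refine Finset.sum_eq_zero fun Z _ => ?_
    beta_reduce
    rw [if_neg, smul_zero]
    exact fun h => hT (h.trans (Subgroup.map_le_range j Z))

/-- Comparison of Möbius transforms along a homomorphism. -/
theorem mob_inf_comap {Y : Type u} [Group Y] [Finite Y] (f : G →* Y)
    (hf : Function.Surjective f) (n : Subgroup G → V) :
    mob n ⊤ = mob (fun X => mob (fun W : Subgroup Y => n (X ⊓ W.comap f)) ⊤) ⊤ := by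
  refine addHom_ext_indicator (A := mobHom ⊤)
    (B := { toFun := fun n => mob (fun X => mob (fun W : Subgroup Y => n (X ⊓ W.comap f)) ⊤) ⊤
            map_zero' := by simp [mob]
            map_add' := fun n n' => by simp [mob, Finset.sum_add_distrib] }) ?_ n
  intro T a
  change mob (fun Z => if T ≤ Z then a else 0) ⊤ =
    mob (fun X => mob (fun W : Subgroup Y => if T ≤ X ⊓ W.comap f then a else 0) ⊤) ⊤
  -- By adjunction `T ≤ W.comap f` means `T.map f ≤ W`, so the inner transform is again that of an
  -- indicator.
  have h : ∀ X : Subgroup G, mob (fun W : Subgroup Y => if T ≤ X ⊓ W.comap f then a else 0) ⊤ =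
      if T ≤ X then (if T.map f = ⊤ then a else 0) else 0 := by
    intro X
    by_cases hX : T ≤ X
    · simp only [le_inf_iff, hX, true_and, if_true]
      simp_rw [← Subgroup.map_le_iff_le_comap]
      rw [mob_indicator]
    · simp [hX, mob]
  simp_rw [h]
  rw [mob_indicator, mob_indicator]
  by_cases hT : T = ⊤
  · subst hT
    simp [← MonoidHom.range_eq_map, MonoidHom.range_eq_top.2 hf]
  · simp [hT]

end Moebius

/-! ## Linear maps on Burnside algebras, and marks -/

theorem sum_univ_eq {α V : Type*} [AddCommMonoid V] (i j : Fintype α) (f : α → V) :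
    (@Finset.univ α i).sum f = (@Finset.univ α j).sum f := by
  rw [Subsingleton.elim i j]

section Functionals

variable {F : Type v} [Field F] {G H : Type u} [Group G] [Group H]

theorem FB.map_cls (f : GSetClass G →+ GSetClass H) (X : FinGSet G) (Y : FinGSet H)
    (h : f (GSetClass.mk X) = GSetClass.mk Y) : FB.map F f (FB.cls F X) = FB.cls F Y := by
  rw [FB.map, FB.cls, LinearMap.baseChange_tmul, FB.cls]
  exact congrArg (fun y => (1 : F) ⊗ₜ[ℤ] y) ((BurnsideGroup.map_of f _).trans (congrArg _ h))

theorem FB.extProd_cls (X : FinGSet G) (Y : FinGSet H) :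
    FB.extProd F (FB.cls F X) (FB.cls F Y) = FB.cls F (FinGSet.extProd X Y) := by
  have h : BurnsideGroup.extProd (Algebra.GrothendieckAddGroup.of (GSetClass.mk X))
      (Algebra.GrothendieckAddGroup.of (GSetClass.mk Y)) =
      Algebra.GrothendieckAddGroup.of (GSetClass.mk (FinGSet.extProd X Y)) := by
    unfold BurnsideGroup.extProd
    erw [DFunLike.congr_fun (Algebra.GrothendieckAddGroup.lift.symm_apply_apply _)
      (GSetClass.mk X)]
    exact BurnsideGroup.map_of _ _
  rw [FB.extProd, FB.cls, FB.cls, LinearMap.liftBaseChange_tmul, one_smul]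
  exact congrArg (fun y => (1 : F) ⊗ₜ[ℤ] y) h

theorem FB.hom_ext {V : Type*} [AddCommGroup V] [Module F V] {f g : FB F G →ₗ[F] V}
    (h : ∀ X : FinGSet G, f (FB.cls F X) = g (FB.cls F X)) : f = g := by
  apply TensorProduct.AlgebraTensorModule.ext
  intro c x
  have h1 : ∀ x : BurnsideGroup G, f ((1 : F) ⊗ₜ[ℤ] x) = g ((1 : F) ⊗ₜ[ℤ] x) := by
    let a (f : FB F G →ₗ[F] V) : BurnsideGroup G →+ V :=
      f.toAddMonoidHom.comp (TensorProduct.mk ℤ F (BurnsideGroup G) 1).toAddMonoidHom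
    have : a f = a g := by
      refine Algebra.GrothendieckAddGroup.lift.symm.injective ?_
      ext b
      obtain ⟨X⟩ := b
      exact h X
    exact fun x => DFunLike.congr_fun this x
  have h2 : c ⊗ₜ[ℤ] x = c • ((1 : F) ⊗ₜ[ℤ] x) := by simp [TensorProduct.smul_tmul']
  rw [h2, map_smul, map_smul, h1]

/-- The linear form on `𝔽B(G)` induced by an additive function of classes of sets. -/
def FB.lift (χ : GSetClass G →+ F) : FB F G →ₗ[F] F :=
  LinearMap.liftBaseChange F (Algebra.GrothendieckAddGroup.lift χ).toIntLinearMap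

theorem FB.lift_cls (χ : GSetClass G →+ F) (X : FinGSet G) :
    FB.lift χ (FB.cls F X) = χ (GSetClass.mk X) := by
  rw [FB.lift, FB.cls, LinearMap.liftBaseChange_tmul, one_smul]
  exact DFunLike.congr_fun (Algebra.GrothendieckAddGroup.lift.symm_apply_apply χ) _

theorem FB.cls_congr {X Y : FinGSet G} (e : X.carrier ≃ Y.carrier)
    (he : ∀ (g : G) (x : X.carrier), e (g • x) = g • e x) : FB.cls F X = FB.cls F Y :=
  congrArg (fun y => (1 : F) ⊗ₜ[ℤ] Algebra.GrothendieckAddGroup.of y) (Quotient.sound ⟨e, he⟩)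

theorem FB.cls_disjUnion (X Y : FinGSet G) :
    FB.cls F (X.disjUnion Y) = FB.cls F X + FB.cls F Y := by
  have h : GSetClass.mk (X.disjUnion Y) = GSetClass.mk X + GSetClass.mk Y := rfl
  rw [FB.cls, h, map_add, TensorProduct.tmul_add]
  rfl

theorem FB.cls_of_isEmpty (X : FinGSet G) [IsEmpty X.carrier] : FB.cls F X = 0 := by
  have h : GSetClass.mk X = 0 :=
    Quotient.sound ⟨Equiv.equivPEmpty _, fun _ x => isEmptyElim x⟩
  rw [FB.cls, h, map_zero, TensorProduct.tmul_zero]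

/-- The number of fixed points of `L`, as an additive function of classes of sets. -/
def markClass (F : Type v) [Field F] (L : Subgroup G) : GSetClass G →+ F where
  toFun := Quotient.lift
    (fun X : FinGSet G => (Nat.card {x : X.carrier // ∀ g ∈ L, g • x = x} : F)) (by
      rintro X Y ⟨e, he⟩
      refine congrArg Nat.cast (Nat.card_congr (e.subtypeEquiv fun x => ?_))
      simp only [← he, e.apply_eq_iff_eq])
  map_zero' := by
    have : IsEmpty (FinGSet.empty G).carrier := inferInstanceAs (IsEmpty PEmpty)
    change ((Nat.card {x : (FinGSet.empty G).carrier // ∀ g ∈ L, g • x = x} : ℕ) : F) = 0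
    rw [Nat.card_of_isEmpty, Nat.cast_zero]
  map_add' := by
    rintro ⟨X⟩ ⟨Y⟩
    change ((Nat.card {x : (X.disjUnion Y).carrier // ∀ g ∈ L, g • x = x} : ℕ) : F) =
      (Nat.card {x : X.carrier // ∀ g ∈ L, g • x = x} : F) +
      (Nat.card {x : Y.carrier // ∀ g ∈ L, g • x = x} : F)
    rw [← Nat.cast_add, ← Nat.card_sum]
    refine congrArg Nat.cast (Nat.card_congr ((Equiv.subtypeSum).trans (Equiv.sumCongr
      (Equiv.subtypeEquivRight fun x => ?_) (Equiv.subtypeEquivRight fun x => ?_))))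
    · exact forall₂_congr fun g _ => Sum.inl_injective.eq_iff (a := g • x)
    · exact forall₂_congr fun g _ => Sum.inr_injective.eq_iff (a := g • x)

/-- The mark at `L`: the linear form on `𝔽B(G)` counting the fixed points of `L`. -/
def mark (L : Subgroup G) : FB F G →ₗ[F] F := FB.lift (markClass F L)

theorem mark_cls (L : Subgroup G) (X : FinGSet G) :
    mark L (FB.cls F X) = (Nat.card {x : X.carrier // ∀ g ∈ L, g • x = x} : F) :=
  FB.lift_cls _ _

theorem mark_cls_eq_sum (L : Subgroup G) (X : FinGSet G) :
    mark L (FB.cls F X) =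
      ∑ x : X.carrier, if L ≤ MulAction.stabilizer G x then (1 : F) else 0 := by
  rw [mark_cls, Nat.card_eq_fintype_card, Fintype.card_subtype, Finset.sum_boole]
  rfl

/-- Sums over a `G`-set of a function of the stabilizers, in terms of marks. -/
theorem sum_stabilizer [Finite G] {V : Type*} [AddCommGroup V] [Module F V] (X : FinGSet G)
    (n : Subgroup G → V) :
    ∑ x : X.carrier, n (MulAction.stabilizer G x) =
      ∑ L : Subgroup G, mark L (FB.cls F X) • mob n L := by
  simp_rw [mark_cls_eq_sum, Finset.sum_smul]
  rw [Finset.sum_comm]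
  refine Finset.sum_congr rfl fun x _ => ?_
  rw [← sum_mob n]
  simp [ite_smul]

theorem mark_comap (f : H →* G) (L : Subgroup H) (a : FB F G) :
    mark L (FB.map F (GSetClass.comap f) a) = mark (L.map f) a := by
  refine DFunLike.congr_fun (f := (mark L).comp (FB.map F (GSetClass.comap f)))
    (FB.hom_ext fun X => ?_) a
  rw [LinearMap.comp_apply, FB.map_cls _ X (X.comap f) rfl, mark_cls, mark_cls]
  refine congrArg Nat.cast (Nat.card_congr (Equiv.subtypeEquivRight fun x => ?_))
  constructor
  · rintro h _ ⟨g, hg, rfl⟩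
    exact h g hg
  · exact fun h g hg => h _ ⟨g, hg, rfl⟩

theorem mark_extProd (L : Subgroup (G × H)) (a : FB F G) (b : FB F H) :
    mark L (FB.extProd F a b) =
      mark (L.map (MonoidHom.fst G H)) a * mark (L.map (MonoidHom.snd G H)) b := by
  have h : (FB.extProd F (G := G) (H := H)).compr₂ (mark L) =
      (LinearMap.mul F F).compl₁₂ (mark (L.map (MonoidHom.fst G H)))
        (mark (L.map (MonoidHom.snd G H))) := by
    refine FB.hom_ext fun X => FB.hom_ext fun Y => ?_
    rw [LinearMap.compr₂_apply, LinearMap.compl₁₂_apply, LinearMap.mul_apply', FB.extProd_cls,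
      mark_cls, mark_cls, mark_cls, ← Nat.cast_mul, ← Nat.card_prod]
    refine congrArg Nat.cast (Nat.card_congr ((Equiv.subtypeEquivRight fun x => ?_).trans
      (Equiv.subtypeProdEquivProd
        (p := fun x : X.carrier => ∀ g ∈ L.map (MonoidHom.fst G H), g • x = x)
        (q := fun y : Y.carrier => ∀ g ∈ L.map (MonoidHom.snd G H), g • y = y))))
    constructor
    · intro h
      constructor
      · rintro _ ⟨g, hg, rfl⟩
        exact congrArg Prod.fst (h g hg)
      · rintro _ ⟨g, hg, rfl⟩
        exact congrArg Prod.snd (h g hg)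
    · exact fun h g hg => Prod.ext (h.1 _ ⟨g, hg, rfl⟩) (h.2 _ ⟨g, hg, rfl⟩)
  exact DFunLike.congr_fun (DFunLike.congr_fun h a) b

end Functionals

/-! ### Idempotents of the Burnside algebra and their marks -/

section Idempotents

variable {F : Type v} [Field F] {G : Type u} [Group G] [Finite G]

/-- The sub-`G`-set on an invariant subset. -/
def FinGSet.restrict (X : FinGSet G) (s : Set X.carrier) (hs : ∀ (g : G), ∀ x ∈ s, g • x ∈ s) :
    FinGSet G where
  carrier := s
  act :=
    { smul := fun g x => ⟨g • x.1, hs g x.1 x.2⟩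
      one_smul := fun x => Subtype.ext (one_smul G x.1)
      mul_smul := fun g h x => Subtype.ext (mul_smul g h x.1) }

theorem FB.cls_transitive (X : FinGSet G) (x : X.carrier) (h : MulAction.orbit G x = Set.univ) :
    FB.cls F (FinGSet.coset (MulAction.stabilizer G x)) = FB.cls F X := by
  refine FB.cls_congr ((MulAction.orbitEquivQuotientStabilizer G x).symm.trans
    ((Equiv.setCongr h).trans (Equiv.Set.univ _))) ?_
  intro g y
  obtain ⟨y⟩ := y
  exact mul_smul g y x

/-- `∑_x |G_x| [G / G_x] = |G| [X]`. -/
theorem FB.sum_coset_stabilizer (X : FinGSet G) :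
    ∑ x : X.carrier, (Nat.card (MulAction.stabilizer G x) : F) •
      FB.cls F (FinGSet.coset (MulAction.stabilizer G x)) = (Nat.card G : F) • FB.cls F X := by
  induction hn : Nat.card X.carrier using Nat.strong_induction_on generalizing X with
  | _ n ih =>
  have key : ∀ X Y : FinGSet G, ∀ e : X.carrier ≃ Y.carrier,
      (∀ (g : G) (x : X.carrier), e (g • x) = g • e x) →
      ∑ x : X.carrier, (Nat.card (MulAction.stabilizer G x) : F) •
        FB.cls F (FinGSet.coset (MulAction.stabilizer G x)) =
      ∑ x : Y.carrier, (Nat.card (MulAction.stabilizer G x) : F) •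
        FB.cls F (FinGSet.coset (MulAction.stabilizer G x)) := by
    intro X Y e he
    refine Fintype.sum_equiv e _ _ fun x => ?_
    have : MulAction.stabilizer G (e x) = MulAction.stabilizer G x := by
      ext g
      simp only [MulAction.mem_stabilizer_iff, ← he, e.apply_eq_iff_eq]
    rw [this]
  rcases isEmpty_or_nonempty X.carrier with hX | ⟨⟨x⟩⟩
  · rw [FB.cls_of_isEmpty, smul_zero, Finset.univ_eq_empty, Finset.sum_empty]
  -- For a transitive set every `G / G_y` is `X` itself and the claim is orbit-stabilizer; otherwise
  -- the orbit of `x` and its complement are both smaller.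
  by_cases hx : MulAction.orbit G x = Set.univ
  · have h : ∀ y : X.carrier, MulAction.orbit G y = Set.univ := fun y => by
      rw [← hx]
      exact MulAction.orbit_eq_iff.2 (hx ▸ Set.mem_univ y)
    simp_rw [fun y => FB.cls_transitive (F := F) X y (h y)]
    rw [← Finset.sum_smul]
    congr 1
    have hc : ∀ y : X.carrier, Nat.card X.carrier * Nat.card (MulAction.stabilizer G y) =
        Nat.card G := fun y => by
      rw [← Nat.card_congr (MulAction.orbitProdStabilizerEquivGroup G y), Nat.card_prod, h,
        Nat.card_univ]
    have hpos : 0 < Nat.card X.carrier := Nat.card_pos_iff.2 ⟨⟨x⟩, inferInstance⟩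
    have hs : ∀ y : X.carrier, Nat.card (MulAction.stabilizer G y) =
        Nat.card (MulAction.stabilizer G x) := fun y =>
      Nat.eq_of_mul_eq_mul_left hpos ((hc y).trans (hc x).symm)
    simp_rw [hs]
    rw [Finset.sum_const, Finset.card_univ, nsmul_eq_mul, ← Nat.card_eq_fintype_card,
      ← Nat.cast_mul, hc]
  · have hs : ∀ g : G, ∀ y ∈ MulAction.orbit G x, g • y ∈ MulAction.orbit G x :=
      fun g y hy => MulAction.mem_orbit_of_mem_orbit g hy
    have ht : ∀ g : G, ∀ y ∈ (MulAction.orbit G x)ᶜ, g • y ∈ (MulAction.orbit G x)ᶜ :=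
      fun g y hy h => hy (by simpa using hs g⁻¹ _ h)
    let X₁ := X.restrict _ hs
    let X₂ := X.restrict _ ht
    let e : (X₁.disjUnion X₂).carrier ≃ X.carrier := Equiv.Set.sumCompl (MulAction.orbit G x)
    have he : ∀ (g : G) (y : (X₁.disjUnion X₂).carrier), e (g • y) = g • e y := by
      rintro g (y | y) <;> rfl
    have hcard : Nat.card X₁.carrier + Nat.card X₂.carrier = n := by
      rw [← hn, ← Nat.card_congr e]
      exact Nat.card_sum.symm
    have h₁ : 0 < Nat.card X₁.carrier :=
      Nat.card_pos_iff.2 ⟨⟨⟨x, MulAction.mem_orbit_self x⟩⟩, inferInstance⟩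
    have h₂ : 0 < Nat.card X₂.carrier := by
      obtain ⟨y, hy⟩ := (Set.ne_univ_iff_exists_notMem _).1 hx
      exact Nat.card_pos_iff.2 ⟨⟨⟨y, hy⟩⟩, inferInstance⟩
    rw [← key _ _ e he, ← FB.cls_congr e he, FB.cls_disjUnion, smul_add,
      ← ih _ (by omega) X₁ rfl, ← ih _ (by omega) X₂ rfl]
    have hsum : ∀ f : (X₁.disjUnion X₂).carrier → FB F G,
        ∑ y, f y = ∑ y : X₁.carrier, f (Sum.inl y) + ∑ y : X₂.carrier, f (Sum.inr y) := by
      intro f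
      have h := Fintype.sum_sum_type (α₁ := X₁.carrier) (α₂ := X₂.carrier) f
      exact (sum_univ_eq _ _ _).trans h
    rw [hsum]
    have h1 : ∀ y : X₁.carrier, MulAction.stabilizer G (α := (X₁.disjUnion X₂).carrier)
        (Sum.inl y) = MulAction.stabilizer G y := fun y => by
      ext g
      exact Sum.inl_injective.eq_iff (a := g • y)
    have h2 : ∀ y : X₂.carrier, MulAction.stabilizer G (α := (X₁.disjUnion X₂).carrier)
        (Sum.inr y) = MulAction.stabilizer G y := fun y => by
      ext g
      exact Sum.inr_injective.eq_iff (a := g • y)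
    simp_rw [h1, h2]

/-- The multiple `|N_G(L)| e_L^G = ∑_X |X| μ(X, L) [G / X]` of the idempotent `e_L^G`. -/
def idemNum (F : Type v) [Field F] (L : Subgroup G) : FB F G :=
  mob (fun X : Subgroup G => (Nat.card X : F) • FB.cls F (FinGSet.coset X)) L

theorem idem_eq (L : Subgroup G) :
    idem F L = (Nat.card (Subgroup.normalizer (L : Set G)) : F)⁻¹ • idemNum F L := by
  rw [idem, idemNum, mob, finsum_eq_sum_of_fintype]
  congr 1
  have h : ∀ X : Subgroup G, moebius X L • (Nat.card X : F) • FB.cls F (FinGSet.coset X) =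
      ((Nat.card X : F) * (moebius X L : F)) • FB.cls F (FinGSet.coset X) := fun X => by
    rw [mul_comm, mul_smul, Int.cast_smul_eq_zsmul]
  simp_rw [h]
  refine (Finset.sum_subtype (Finset.univ.filter (· ≤ L)) (by simp) fun X : Subgroup G =>
    ((Nat.card X : F) * (moebius X L : F)) • FB.cls F (FinGSet.coset X)).symm.trans ?_
  rw [Finset.sum_filter]
  refine Finset.sum_congr rfl fun X _ => ?_
  split_ifs with hX
  · rfl
  · simp [moebius_eq_zero hX]

/-- In characteristic zero the factor `|N_G(L)|` is invertible, so the unnormalised `idemNum` serves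
equally well for questions of membership. -/
theorem idem_mem_iff [CharZero F] (L : Subgroup G) (W : Submodule F (FB F G)) :
    idem F L ∈ W ↔ idemNum F L ∈ W := by
  rw [idem_eq, Submodule.smul_mem_iff]
  exact inv_ne_zero (Nat.cast_ne_zero.2 Nat.card_pos.ne')

/-- Every element of `𝔽B(G)` is determined by its marks. -/
theorem card_smul_eq_sum_mark (a : FB F G) :
    (Nat.card G : F) • a = ∑ L : Subgroup G, mark L a • idemNum F L := by
  have h : (Nat.card G : F) • LinearMap.id =
      ∑ L : Subgroup G, (mark L).smulRight (idemNum F L) := by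
    refine FB.hom_ext fun X => ?_
    rw [LinearMap.smul_apply, LinearMap.id_apply, ← FB.sum_coset_stabilizer, LinearMap.sum_apply]
    exact sum_stabilizer X fun L : Subgroup G =>
      (Nat.card L : F) • FB.cls F (FinGSet.coset L)
  simpa using DFunLike.congr_fun h a

theorem ext_mark [CharZero F] {a b : FB F G} (h : ∀ L : Subgroup G, mark L a = mark L b) :
    a = b := by
  refine smul_right_injective _ (Nat.cast_ne_zero.2 (Nat.card_pos (α := G)).ne' : (_ : F) ≠ 0) ?_
  simp only [card_smul_eq_sum_mark, h]

/-- The coset `gX` is fixed by `H` iff `g⁻¹Hg ≤ X`, and each coset has `|X|` representatives;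
replacing `g` by its inverse gives the stated conjugation. -/
theorem card_mul_mark_coset (H X : Subgroup G) :
    (Nat.card X : F) * mark H (FB.cls F (FinGSet.coset X)) =
      ∑ g : G, if H.map (MulAut.conj g).toMonoidHom ≤ X then 1 else 0 := by
  have h : ∀ f : G ⧸ X → F, ∑ g : G, f (QuotientGroup.mk g) = (Nat.card X : F) * ∑ x, f x := by
    intro f
    refine (Fintype.sum_equiv (Subgroup.groupEquivQuotientProdSubgroup (s := X)) _
      (fun y => f y.1) fun _ => rfl).trans ?_
    refine ((Fintype.sum_equiv (Equiv.refl _) _ _ fun _ => rfl).trans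
      (Fintype.sum_prod_type fun y : (G ⧸ X) × X => f y.1)).trans ?_
    simp [Finset.mul_sum, Nat.card_eq_fintype_card]
  rw [mark_cls_eq_sum]
  refine (congrArg (fun c => (Nat.card X : F) * c) (sum_univ_eq _ _ _)).trans
    ((h fun x => if H ≤ MulAction.stabilizer G x then 1 else 0).symm.trans ?_)
  refine Fintype.sum_equiv (Equiv.inv G) _ _ fun g => if_congr ?_ rfl rfl
  rw [Subgroup.map_le_iff_le_comap]
  refine forall₂_congr fun h _ => ?_
  rw [MulAction.mem_stabilizer_iff, Subgroup.mem_comap]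
  change (QuotientGroup.mk (h * g) : G ⧸ X) = QuotientGroup.mk g ↔ g⁻¹ * h * g⁻¹⁻¹ ∈ X
  rw [eq_comm, QuotientGroup.eq, inv_inv, mul_assoc]

/-- The Möbius transform in `X` turns the condition `≤ X` of `card_mul_mark_coset` into `= L`. -/
theorem mark_idemNum (H L : Subgroup G) :
    mark H (idemNum F L) =
      ∑ g : G, if H.map (MulAut.conj g).toMonoidHom = L then (1 : F) else 0 := by
  rw [idemNum]
  refine (mob_comp (mark (F := F) H).toAddMonoidHom
    (fun X : Subgroup G => (Nat.card X : F) • FB.cls F (FinGSet.coset X)) L).trans ?_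
  have h : ∀ X : Subgroup G, (mark (F := F) H).toAddMonoidHom
      ((Nat.card X : F) • FB.cls F (FinGSet.coset X)) =
      ∑ g : G, if H.map (MulAut.conj g).toMonoidHom ≤ X then (1 : F) else 0 := fun X => by
    rw [← card_mul_mark_coset]
    simp
  simp_rw [h]
  rw [mob_sum]
  simp_rw [mob_indicator]

theorem mark_idemNum_ne_zero_iff [CharZero F] (H L : Subgroup G) :
    mark H (idemNum F L) ≠ 0 ↔ ∃ g : G, H.map (MulAut.conj g).toMonoidHom = L := by
  rw [mark_idemNum, Finset.sum_boole, Nat.cast_ne_zero, Finset.card_ne_zero]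
  simp only [Finset.Nonempty, Finset.mem_filter, Finset.mem_univ, true_and]

theorem idemNum_conj [CharZero F] (L : Subgroup G) (g : G) :
    idemNum F (L.map (MulAut.conj g).toMonoidHom) = idemNum F L := by
  refine ext_mark fun H => ?_
  rw [mark_idemNum, mark_idemNum]
  refine Fintype.sum_equiv (Equiv.mulLeft g⁻¹) _ _ fun h => ?_
  congr 1
  have : H.map (MulAut.conj h).toMonoidHom =
      (H.map (MulAut.conj (g⁻¹ * h)).toMonoidHom).map (MulAut.conj g).toMonoidHom := by
    rw [Subgroup.map_map]
    congr 1
    ext x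
    simp [mul_assoc]
  rw [this, (Subgroup.map_injective (MulAut.conj g).injective).eq_iff]
  rfl

end Idempotents

/-! ## Marks of the image under a biset -/

theorem card_mul_card_inf {L : Type u} [Group L] [Finite L] {Z N : Subgroup L} [N.Normal]
    (h : Z ⊔ N = ⊤) : Nat.card L * Nat.card (Z ⊓ N : Subgroup L) = Nat.card N * Nat.card Z := by
  have h1 : N.index = N.relIndex Z := by
    rw [← Subgroup.relIndex_sup_right, h, Subgroup.relIndex_top_right]
  rw [← N.card_mul_index, h1, mul_assoc, ← Subgroup.inf_relIndex_left, mul_comm (Subgroup.relIndex _ _),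
    ← Subgroup.relIndex_bot_left (Z ⊓ N), Subgroup.relIndex_mul_relIndex _ _ _ bot_le inf_le_left,
    Subgroup.relIndex_bot_left]

section BisetMarks

variable {F : Type v} [Field F] {G H : Type u} [Group G] [Group H] [Finite G]

/-- Orbit-stabilizer: `g ↦ b · g` fibres `G` over the orbit of `b`, and the fibre over `b · k` is
the left translate by `k` of the stabilizer of `b · k`. -/
theorem Biset.card_eq_sum_orbit (V : Biset H G) (X : FinGSet G)
    (q : Quotient (V.orbitSetoid X)) :
    ∑ a : V.carrier × X.carrier, (if Quotient.mk (V.orbitSetoid X) a = q then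
      Nat.card {g : G // (MulOpposite.op g • a.1, g⁻¹ • a.2) = a} else 0) = Nat.card G := by
  induction q using Quotient.inductionOn with
  | _ b =>
  rw [← Finset.sum_filter, Nat.card_eq_fintype_card, ← Finset.card_univ]
  have hmaps : ∀ g ∈ (Finset.univ : Finset G), (MulOpposite.op g • b.1, g⁻¹ • b.2) ∈
      Finset.univ.filter fun a => Quotient.mk (V.orbitSetoid X) a = Quotient.mk _ b := by
    intro g _
    simp only [Finset.mem_filter, Finset.mem_univ, true_and]
    exact (Quotient.sound ⟨g, rfl⟩ : Quotient.mk (V.orbitSetoid X) b = _).symm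
  rw [Finset.card_eq_sum_card_fiberwise hmaps]
  refine Finset.sum_congr rfl fun a ha => ?_
  simp only [Finset.mem_filter, Finset.mem_univ, true_and] at ha
  obtain ⟨k, rfl⟩ := Quotient.exact ha.symm
  rw [Nat.card_eq_fintype_card, Fintype.card_subtype]
  refine Finset.card_equiv (Equiv.mulLeft k) fun g => ?_
  simp only [Finset.mem_filter, Finset.mem_univ, true_and, Equiv.coe_mulLeft, MulOpposite.op_mul,
    mul_inv_rev, mul_smul]

theorem Biset.card_mul_card_orbits (V : Biset H G) (X : FinGSet G)
    (p : Quotient (V.orbitSetoid X) → Prop) :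
    Nat.card G * Nat.card {q // p q} =
      ∑ a : V.carrier × X.carrier, if p (Quotient.mk (V.orbitSetoid X) a) then
        Nat.card {g : G // (MulOpposite.op g • a.1, g⁻¹ • a.2) = a} else 0 := by
  rw [← Finset.sum_fiberwise (Finset.univ : Finset (V.carrier × X.carrier))
    (Quotient.mk (V.orbitSetoid X))]
  have h : ∀ q : Quotient (V.orbitSetoid X),
      (∑ a : V.carrier × X.carrier with Quotient.mk (V.orbitSetoid X) a = q,
        if p (Quotient.mk (V.orbitSetoid X) a) then
          Nat.card {g : G // (MulOpposite.op g • a.1, g⁻¹ • a.2) = a} else 0) =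
      if p q then Nat.card G else 0 := by
    intro q
    rw [← V.card_eq_sum_orbit X q]
    split_ifs with hq
    · rw [Finset.sum_filter]
      refine Finset.sum_congr rfl fun a _ => ?_
      split_ifs with h1 h2
      · rfl
      · exact absurd (h1 ▸ hq) h2
      · rfl
    · rw [Finset.sum_filter]
      refine Finset.sum_eq_zero fun a _ => ?_
      split_ifs with h1 h2
      · exact absurd (h1 ▸ h2) hq
      · rfl
      · rfl
  simp_rw [h]
  rw [Finset.sum_ite, Finset.sum_const_zero, add_zero, Finset.sum_const, smul_eq_mul, mul_comm,
    Nat.card_eq_fintype_card (α := {q // p q}), Fintype.card_subtype]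

/-- The contribution to the mark at `M` of `V ×_G X` of a pair `(v, x)` with `Z = G_x`. -/
def Biset.weight (F : Type v) [Field F] (V : Biset H G) (M : Subgroup H) (v : V.carrier)
    (Z : Subgroup G) : F :=
  if ∀ m ∈ M, ∃ g ∈ Z, m • v = MulOpposite.op g • v then
    (Nat.card {g : G // g ∈ Z ∧ MulOpposite.op g • v = v} : F) else 0

/-- Orbits fixed by `M` are counted by pairs `(v, x)` weighted by the order of their stabilizer. For
fixed `v` the contribution depends on `x` only through its stabilizer, so `sum_stabilizer` expresses
the sum by marks of `X`, and linearity does the rest. -/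
theorem card_mul_mark_compClass (V : Biset H G) (M : Subgroup H) (a : FB F G) :
    (Nat.card G : F) * mark M (FB.map F V.compClass a) =
      ∑ v : V.carrier, ∑ L : Subgroup G, mark L a * mob (V.weight F M v) L := by
  have h : (Nat.card G : F) • (mark M).comp (FB.map F V.compClass) =
      ∑ v : V.carrier, ∑ L : Subgroup G, (mark L).smulRight (mob (V.weight F M v) L) := by
    refine FB.hom_ext fun X => ?_
    rw [LinearMap.smul_apply, LinearMap.comp_apply, FB.map_cls _ X (V.compSet X) rfl, mark_cls,
      LinearMap.sum_apply, smul_eq_mul, ← Nat.cast_mul]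
    refine (congrArg Nat.cast (V.card_mul_card_orbits X fun q =>
      ∀ m ∈ M, (m • (show (V.compSet X).carrier from q)) = q)).trans ?_
    rw [Fintype.sum_prod_type, Nat.cast_sum]
    refine Finset.sum_congr rfl fun v _ => ?_
    rw [LinearMap.sum_apply]
    refine Eq.trans ?_ (sum_stabilizer X (V.weight F M v))
    rw [Nat.cast_sum]
    refine Finset.sum_congr rfl fun x _ => ?_
    rw [Biset.weight, Nat.cast_ite, Nat.cast_zero]
    refine if_congr (forall₂_congr fun m _ => ?_) (congrArg Nat.cast (Nat.card_congr
      (Equiv.subtypeEquivRight fun g => ?_))) rfl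
    · refine (Quotient.eq (r := V.orbitSetoid X) (x := (m • v, x)) (y := (v, x))).trans ?_
      constructor
      · rintro ⟨g, hg⟩
        obtain ⟨h1, h2⟩ := Prod.ext_iff.1 hg
        refine ⟨g⁻¹, ?_, ?_⟩
        · exact h2.symm
        · change v = MulOpposite.op g • m • v at h1
          rw [MulOpposite.op_inv, eq_inv_smul_iff, ← h1]
      · rintro ⟨g, hg, h⟩
        refine ⟨g⁻¹, Prod.ext ?_ ?_⟩
        · change v = MulOpposite.op g⁻¹ • m • v
          rw [h, MulOpposite.op_inv, inv_smul_smul]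
        · change x = g⁻¹⁻¹ • x
          rw [inv_inv]
          exact hg.symm
    · rw [Prod.ext_iff, and_comm, MulAction.mem_stabilizer_iff]
      refine and_congr_left fun _ => ?_
      change g⁻¹ • x = x ↔ g • x = x
      rw [inv_smul_eq_iff, eq_comm]
  simpa using DFunLike.congr_fun h a

/-- If the transform of the weight does not vanish at `L`, then `L` acts on the orbit of `v`
as `M` does. -/
theorem Biset.of_mob_weight_ne_zero {V : Biset H G} {M : Subgroup H} {v : V.carrier}
    {L : Subgroup G} (h : mob (V.weight F M v) L ≠ 0) :
    (∀ m ∈ M, ∃ g ∈ L, m • v = MulOpposite.op g • v) ∧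
      ∀ g ∈ L, ∃ m ∈ M, m • v = MulOpposite.op g • v := by
  constructor
  · by_contra hL
    refine h ((mob_congr (n' := fun _ => 0) fun Z hZ => if_neg fun hc => hL ?_).trans
      (by simp [mob]))
    exact fun m hm => (hc m hm).imp fun g hg => ⟨hZ hg.1, hg.2⟩
  · by_contra hL
    -- `Q` consists of the elements that act on `v` as some element of `M` does. The weight at `Z`
    -- depends only on `Z ⊓ Q`, so its transform vanishes unless `L ≤ Q`.
    let Q : Subgroup G :=
      { carrier := {g | ∃ m ∈ M, m • v = MulOpposite.op g • v}
        one_mem' := ⟨1, one_mem M, by simp⟩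
        mul_mem' := by
          rintro a b ⟨m, hm, ha⟩ ⟨m', hm', hb⟩
          refine ⟨m * m', mul_mem hm hm', ?_⟩
          rw [mul_smul, hb, smul_comm, ha, MulOpposite.op_mul, mul_smul]
        inv_mem' := by
          rintro a ⟨m, hm, ha⟩
          refine ⟨m⁻¹, inv_mem hm, ?_⟩
          rw [inv_smul_eq_iff, smul_comm, ha, MulOpposite.op_inv, inv_smul_smul] }
    refine h (mob_eq_zero_of_inf Q (fun Z => ?_) hL)
    have hQ : ∀ g : G, MulOpposite.op g • v = v → g ∈ Q := fun g hg => ⟨1, one_mem M, by simp [hg]⟩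
    unfold Biset.weight
    refine if_congr (forall₂_congr fun m hm => exists_congr fun g => ?_)
      (congrArg Nat.cast (Nat.card_congr (Equiv.subtypeEquivRight fun g => ?_))) rfl
    · exact ⟨fun h => ⟨⟨h.1, m, hm, h.2⟩, h.2⟩, fun h => ⟨h.1.1, h.2⟩⟩
    · exact ⟨fun h => ⟨⟨h.1, hQ g h.2⟩, h.2⟩, fun h => ⟨h.1.1, h.2⟩⟩

/-- The transform of the weight at the image of an injective homomorphism `j`, when `M` and the
image of `j` act in the same way on the orbit of `v`. -/
theorem Biset.card_mul_mob_weight {V : Biset H G} {M : Subgroup H} {v : V.carrier}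
    {L : Type u} [Group L] [Finite L] (j : L →* G) (hj : Function.Injective j)
    (h₁ : ∀ m ∈ M, ∃ l, m • v = MulOpposite.op (j l) • v)
    (h₂ : ∀ l, ∃ m ∈ M, m • v = MulOpposite.op (j l) • v)
    (N : Subgroup L) [N.Normal] (hN : ∀ l, l ∈ N ↔ MulOpposite.op (j l) • v = v) :
    (Nat.card L : F) * mob (V.weight F M v) j.range =
      Nat.card N * mob (fun Z : Subgroup L => if Z ⊔ N = ⊤ then (Nat.card Z : F) else 0) ⊤ := by
  rw [mob_range j hj]
  let c (b : F) : F →+ F := AddMonoidHom.mulLeft b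
  refine (mob_comp (c _) _ _).trans (Eq.trans ?_ (mob_comp (c _) _ _).symm)
  congr 1
  funext Z
  -- `M` moves `v` exactly as `L / N` does, so the elements of `Z` suffice for this precisely when
  -- `Z` covers `L / N`.
  have hZ : (∀ m ∈ M, ∃ g ∈ Z.map j, m • v = MulOpposite.op g • v) ↔ Z ⊔ N = ⊤ := by
    constructor
    · intro h
      rw [eq_top_iff]
      intro l _
      obtain ⟨m, hm, hml⟩ := h₂ l
      obtain ⟨_, ⟨z, hz, rfl⟩, hg⟩ := h m hm
      have : l * z⁻¹ ∈ N := by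
        rw [hN, map_mul, map_inv, MulOpposite.op_mul, mul_smul, ← hml, hg, MulOpposite.op_inv,
          inv_smul_smul]
      rw [sup_comm, Subgroup.mem_sup_of_normal_left]
      exact ⟨_, this, z, hz, by simp⟩
    · intro h m hm
      obtain ⟨l, hl⟩ := h₁ m hm
      have : l ∈ N ⊔ Z := by
        rw [sup_comm, h]
        exact Subgroup.mem_top l
      obtain ⟨y, hy, z, hz, rfl⟩ := Subgroup.mem_sup_of_normal_left.1 this
      refine ⟨j z, ⟨z, hz, rfl⟩, ?_⟩
      rw [hl, map_mul, MulOpposite.op_mul, mul_smul, (hN y).1 hy]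
  unfold Biset.weight
  simp only [hZ]
  split_ifs with h
  · change (Nat.card L : F) * _ = Nat.card N * _
    -- The weight counts `Z ⊓ N`; the identity `|L| |Z ⊓ N| = |N| |Z|` replaces it by the factor
    -- `|Z|` of `m_{L,N}`.
    rw [← Nat.cast_mul, ← Nat.cast_mul, ← card_mul_card_inf h]
    refine congrArg (fun k : ℕ => ((Nat.card L * k : ℕ) : F)) (Nat.card_congr ?_).symm
    refine Equiv.ofBijective (fun z : (Z ⊓ N : Subgroup L) =>
      ⟨j z.1, ⟨z.1, z.2.1, rfl⟩, (hN z.1).1 z.2.2⟩) ⟨?_, ?_⟩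
    · exact fun z z' h => Subtype.ext (hj (congrArg Subtype.val h))
    · rintro ⟨_, ⟨z, hz, rfl⟩, hg⟩
      exact ⟨⟨z, hz, (hN z).2 hg⟩, rfl⟩
  · exact (map_zero _).trans (map_zero _).symm

end BisetMarks

/-! ## The constants `m_{L,N}` -/

section Constants

variable {L : Type u} [Group L]

theorem card_inf_comap {Y : Type u} [Group Y] (f : L →* Y) {X : Subgroup L}
    (hX : X.map f = ⊤) (W : Subgroup Y) :
    Nat.card (X ⊓ W.comap f : Subgroup L) = Nat.card (X ⊓ f.ker : Subgroup L) * Nat.card W := by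
  have h1 : (X ⊓ W.comap f).map f = W := by
    refine le_antisymm ?_ fun w hw => ?_
    · rintro _ ⟨x, hx, rfl⟩
      exact hx.2
    · obtain ⟨x, hx, rfl⟩ : w ∈ X.map f := hX ▸ Subgroup.mem_top w
      exact ⟨x, ⟨hx, hw⟩, rfl⟩
  have h2 : X ⊓ W.comap f ⊓ f.ker = X ⊓ f.ker := by
    rw [inf_assoc, inf_eq_right.2 (f.ker_le_comap W)]
  have h3 : X ⊓ f.ker ≤ X ⊓ W.comap f := inf_le_inf_left X (f.ker_le_comap W)
  conv_rhs => rw [← h1, ← Subgroup.relIndex_ker, ← Subgroup.inf_relIndex_left, h2]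
  rw [← Subgroup.relIndex_bot_left (X ⊓ f.ker),
    Subgroup.relIndex_mul_relIndex _ _ _ bot_le h3, Subgroup.relIndex_bot_left]

theorem normal_map_inf {Y : Type u} [Group Y] (f : L →* Y) {X N : Subgroup L} [N.Normal]
    (hX : X.map f = ⊤) : ((X ⊓ N).map f).Normal := by
  refine ⟨?_⟩
  rintro _ ⟨n, hn, rfl⟩ y
  obtain ⟨x, hx, rfl⟩ : y ∈ X.map f := hX ▸ Subgroup.mem_top y
  exact ⟨x * n * x⁻¹, ⟨X.mul_mem (X.mul_mem hx hn.1) (X.inv_mem hx),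
    Subgroup.Normal.conj_mem ‹_› n hn.2 x⟩, by simp⟩

/-- Given `XN = L`, the left condition says that `X ⊓ f⁻¹(W)` and `X ⊓ N` generate `X`; applying `f`
gives the right one. -/
theorem inf_comap_sup_eq_top_iff {Y : Type u} [Group Y] (f : L →* Y) {X N : Subgroup L}
    [N.Normal] (hX : X.map f = ⊤) (hXN : X ⊔ N = ⊤) (W : Subgroup Y) :
    X ⊓ W.comap f ⊔ N = ⊤ ↔ W ⊔ (X ⊓ N).map f = ⊤ := by
  have hn := normal_map_inf f (N := N) hX
  constructor
  · intro h
    rw [eq_top_iff]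
    intro y _
    obtain ⟨x, hx, rfl⟩ : y ∈ X.map f := hX ▸ Subgroup.mem_top y
    have hx' : x ∈ X ⊓ W.comap f ⊔ N := h ▸ Subgroup.mem_top x
    obtain ⟨z, hz, n, hn, rfl⟩ := Subgroup.mem_sup_of_normal_right.1 hx'
    rw [map_mul]
    refine mul_mem (Subgroup.mem_sup_left hz.2) (Subgroup.mem_sup_right ⟨n, ⟨?_, hn⟩, rfl⟩)
    simpa using X.mul_mem (X.inv_mem hz.1) hx
  · intro h
    rw [eq_top_iff, ← hXN]
    refine sup_le (fun x hx => ?_) le_sup_right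
    have hy : f x ∈ W ⊔ (X ⊓ N).map f := h ▸ Subgroup.mem_top _
    obtain ⟨w, hw, _, ⟨n, hn, rfl⟩, hwn⟩ := Subgroup.mem_sup_of_normal_right.1 hy
    have h1 : x * n⁻¹ ∈ X ⊓ W.comap f := by
      refine ⟨X.mul_mem hx (X.inv_mem hn.1), ?_⟩
      change f (x * n⁻¹) ∈ W
      rw [map_mul, map_inv, ← hwn, mul_inv_cancel_right]
      exact hw
    simpa using mul_mem (Subgroup.mem_sup_left h1) (Subgroup.mem_sup_right (S := X ⊓ W.comap f) hn.2)

variable [Finite L]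

/-- The sum `|L| m_{L,N}`, with values in a ring. -/
def mSum (F : Type v) [Ring F] (N : Subgroup L) : F :=
  mob (fun Z : Subgroup L => if Z ⊔ N = ⊤ then (Nat.card Z : F) else 0) ⊤

theorem mSum_eq_intCast (F : Type v) [Ring F] (N : Subgroup L) :
    mSum F N = ((mSum ℤ N : ℤ) : F) := by
  refine Eq.trans ?_ (mob_comp (Int.castAddHom F) _ _).symm
  unfold mSum
  congr 1
  funext Z
  split_ifs <;> simp

theorem mConst_eq (N : Subgroup L) : mConst N = (Nat.card L : ℚ)⁻¹ * mSum ℚ N := by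
  rw [mConst, finsum_eq_sum_of_fintype]
  congr 1
  refine (Finset.sum_subtype (Finset.univ.filter (· ⊔ N = ⊤)) (by simp) fun X : Subgroup L =>
    (Nat.card X : ℚ) * (moebius X ⊤ : ℚ)).symm.trans ?_
  rw [Finset.sum_filter]
  refine Finset.sum_congr rfl fun X _ => ?_
  beta_reduce
  split_ifs
  · rw [zsmul_eq_mul, mul_comm]
  · rw [smul_zero]

/-- The number `|L| m_{L,N}` is an integer, so its vanishing can be tested in any field of
characteristic zero. -/
theorem mConst_eq_zero_iff (F : Type v) [Field F] [CharZero F] (N : Subgroup L) :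
    mConst N = 0 ↔ mSum F N = 0 := by
  rw [mConst_eq, mSum_eq_intCast, mSum_eq_intCast F, mul_eq_zero, Int.cast_eq_zero,
    Int.cast_eq_zero, or_iff_right]
  exact inv_ne_zero (Nat.cast_ne_zero.2 Nat.card_pos.ne')

/-- Only `Z = L` supplements the trivial subgroup. Nonvanishing of this value lets embeddings be
treated as the case `N = 1` of `GreenIdeal.idemNum_mem_of_mSum_ne_zero`. -/
theorem mSum_bot (F : Type v) [Ring F] : mSum F (⊥ : Subgroup L) = Nat.card L := by
  have h : (fun Z : Subgroup L => if Z ⊔ ⊥ = ⊤ then (Nat.card Z : F) else 0) =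
      fun Z => if ⊤ ≤ Z then (Nat.card L : F) else 0 := by
    funext Z
    rw [sup_bot_eq, top_le_iff]
    split_ifs with h
    · rw [h, Subgroup.card_top]
    · rfl
  rw [mSum, h, mob_indicator, if_pos rfl]

theorem mSum_map_equiv (F : Type v) [Ring F] {L' : Type u} [Group L'] [Finite L'] (e : L ≃* L')
    (N : Subgroup L) : mSum F (N.map e.toMonoidHom) = mSum F N := by
  have h : e.toMonoidHom.range = ⊤ := MonoidHom.range_eq_top.2 e.surjective
  rw [mSum, ← h, mob_range _ e.injective, h, mSum]
  congr 1
  funext Z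
  rw [← Subgroup.map_sup, ← h, MonoidHom.range_eq_map, (Subgroup.map_injective e.injective).eq_iff,
    Nat.card_congr (Z.equivMapOfInjective _ e.injective).symm.toEquiv]

/-- If `m_{L,N} ≠ 0` and `Y` is a quotient of `L` whose constants at normal subgroups in the image
of `N` vanish, then `Y` is already a quotient of `L / N`. -/
theorem exists_supplement_of_mSum_ne_zero {F : Type v} [Field F] {Y : Type u} [Group Y] [Finite Y]
    (f : L →* Y) (hf : Function.Surjective f) (N : Subgroup L) [N.Normal] (h : mSum F N ≠ 0)
    (hY : ∀ N' : Subgroup Y, N'.Normal → N' ≠ ⊥ → N' ≤ N.map f → mSum F N' = 0) :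
    ∃ X : Subgroup L, X ⊔ N = ⊤ ∧ X.map f = ⊤ ∧ (X ⊓ N).map f = ⊥ := by
  by_contra! hc
  refine h ?_
  -- Every term indexed by `X` is shown to vanish. If `XN ≠ L`, no `W` contributes; if `f(X) ≠ Y`,
  -- the inner function depends only on `W ⊓ f(X)`; otherwise the inner transform is `|X ⊓ Ker f|`
  -- times the constant at `f(X ⊓ N)`, which is zero by `hY`, since `hc` excludes the trivial
  -- subgroup.
  rw [mSum, mob_inf_comap f hf]
  refine Finset.sum_eq_zero fun X _ => ?_
  beta_reduce
  refine (congrArg _ ?_).trans (smul_zero _)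
  by_cases hXN : X ⊔ N = ⊤
  swap
  · refine Finset.sum_eq_zero fun W _ => ?_
    beta_reduce
    rw [if_neg, smul_zero]
    exact fun hW => hXN (top_le_iff.1 (hW ▸ sup_le_sup_right inf_le_left N))
  by_cases hX : X.map f = ⊤
  swap
  · refine mob_eq_zero_of_inf (X.map f) (fun W => ?_) fun h => hX (top_le_iff.1 h)
    have : X ⊓ (W ⊓ X.map f).comap f = X ⊓ W.comap f := by
      rw [Subgroup.comap_inf, ← inf_assoc, inf_right_comm, inf_eq_left.2 (Subgroup.le_comap_map f X)]
    rw [this]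
  have hn : (fun W : Subgroup Y => if X ⊓ W.comap f ⊔ N = ⊤ then
      (Nat.card (X ⊓ W.comap f : Subgroup L) : F) else 0) =
      fun W => AddMonoidHom.mulLeft (Nat.card (X ⊓ f.ker : Subgroup L) : F)
        (if W ⊔ (X ⊓ N).map f = ⊤ then (Nat.card W : F) else 0) := by
    funext W
    rw [inf_comap_sup_eq_top_iff f hX hXN, card_inf_comap f hX]
    split_ifs <;> simp
  rw [hn, ← mob_comp]
  have h0 : mSum F ((X ⊓ N).map f) = 0 :=
    hY _ (normal_map_inf f hX) (hc X hXN hX) (Subgroup.map_mono inf_le_right)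
  exact (congrArg _ h0).trans (map_zero _)

end Constants

/-! ## Bisets attached to homomorphisms, and ideals -/

section HomBisets

variable {G H : Type u} [Group G] [Group H]

/-- The `(H, G)`-biset `G`, on which `H` acts through a homomorphism `H → G`. -/
def Biset.res [Finite G] (f : H →* G) : Biset H G :=
  letI left : MulAction H G := MulAction.compHom G f
  { carrier := G
    left := left
    right := inferInstance
    comm := ⟨fun h g x => (mul_assoc (f h) x g.unop).symm⟩ }

/-- The `(G, H)`-biset `G`, on which `H` acts through a homomorphism `H → G`. -/
def Biset.ind [Finite G] (f : H →* G) : Biset G H :=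
  letI right : MulAction Hᵐᵒᵖ G :=
    { smul := fun h g => g * f h.unop
      one_smul := fun g => by change g * f 1 = g; simp
      mul_smul := fun a b g => by
        change g * f (b.unop * a.unop) = g * f b.unop * f a.unop
        rw [map_mul, mul_assoc] }
  { carrier := G
    left := inferInstance
    right := right
    comm := ⟨fun g h x => (mul_assoc g x (f h.unop)).symm⟩ }

variable {F : Type v} [Field F] {K : Type u} [Group K]

theorem compClass_shift_res [Finite G] [Finite K] (f : H →* G) :
    ((Biset.res f).shift K).compClass = GSetClass.comap (f.prodMap (MonoidHom.id K)) := by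
  ext a
  obtain ⟨X⟩ := a
  refine Quotient.sound ⟨?_, ?_⟩
  · refine
      { toFun := Quotient.lift (fun a => (show G × K from a.1) • a.2) ?_
        invFun := fun x => Quotient.mk _ ((1 : G × K), (show X.carrier from x))
        left_inv := ?_
        right_inv := fun x => one_smul (G × K) (show X.carrier from x) }
    · rintro ⟨u, x⟩ b ⟨g, rfl⟩
      change (show G × K from u) • x = ((show G × K from u) * g) • g⁻¹ • x
      rw [mul_smul, smul_inv_smul]
    · rintro ⟨u, x⟩
      refine Quotient.sound ⟨(show G × K from u), Prod.ext ?_ ?_⟩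
      · exact (one_mul (show G × K from u)).symm
      · exact (inv_smul_smul (show G × K from u) x).symm
  · rintro h ⟨u, x⟩
    exact mul_smul (f.prodMap (MonoidHom.id K) h) (show G × K from u) x

theorem mark_ofBiset_res [Finite G] [Finite K] (f : H →* G) (L : Subgroup (H × K)) (a : FBK F K G) :
    mark L (FBK.ofBiset F K (Biset.res f) a) =
      mark (L.map (f.prodMap (MonoidHom.id K))) a := by
  rw [FBK.ofBiset, compClass_shift_res, mark_comap]

theorem mark_prod (L : Subgroup ((G × H) × K)) (a : FBK F K G) (b : FBK F K H) :
    mark L (FBK.prod F K a b) =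
      mark (L.map ((MonoidHom.fst G H).prodMap (MonoidHom.id K))) a *
        mark (L.map ((MonoidHom.snd G H).prodMap (MonoidHom.id K))) b := by
  rw [FBK.prod, LinearMap.compr₂_apply, mark_comap, mark_extProd, Subgroup.map_map,
    Subgroup.map_map]
  rfl

theorem mark_conj (L : Subgroup G) (g : G) (a : FB F G) :
    mark (L.map (MulAut.conj g).toMonoidHom) a = mark L a := by
  refine DFunLike.congr_fun (FB.hom_ext fun X => ?_) a
  rw [mark_cls, mark_cls]
  refine congrArg Nat.cast (Nat.card_congr ((MulAction.toPerm g⁻¹).subtypeEquiv fun x => ?_))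
  constructor
  · intro h l hl
    have := h _ ⟨l, hl, rfl⟩
    change (g * l * g⁻¹) • x = x at this
    change l • g⁻¹ • x = g⁻¹ • x
    rwa [eq_inv_smul_iff, smul_smul, smul_smul]
  · rintro h _ ⟨l, hl, rfl⟩
    have := h l hl
    change l • g⁻¹ • x = g⁻¹ • x at this
    change (g * l * g⁻¹) • x = x
    rwa [eq_inv_smul_iff, smul_smul, smul_smul] at this

end HomBisets

namespace GreenIdeal

variable {F : Type v} [Field F] [CharZero F] {K : Type u} [Group K] [Finite K]
  {D : GroupClass.{u}} (I : GreenIdeal F K D)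
  {G H : Type u} [Group G] [Group H] [Finite G] [Finite H]

/-- Restricting an external product to the diagonal multiplies marks. Multiplying `a` by `idemNum F
L` in this way leaves the multiple `mark L a • idemNum F L`. -/
theorem idemNum_mem_of_mark_ne_zero (hG : D.Mem G) {a : FBK F K G} (ha : a ∈ I.eval G hG)
    {L : Subgroup (G × K)} (hL : mark L a ≠ 0) : idemNum F L ∈ I.eval G hG := by
  let δ : G →* G × G := (MonoidHom.id G).prod (MonoidHom.id G)
  have hc : FBK.ofBiset F K (Biset.res δ) (FBK.prod F K (idemNum F L) a) ∈ I.eval G hG :=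
    I.biset_mem _ hG _ _ (I.prod_mem_left hG hG _ _ ha)
  have h : FBK.ofBiset F K (Biset.res δ) (FBK.prod F K (idemNum F L) a) =
      mark L a • idemNum F L := by
    refine ext_mark fun M => ?_
    have h1 : (M.map (δ.prodMap (MonoidHom.id K))).map
        ((MonoidHom.fst G G).prodMap (MonoidHom.id K)) = M := by
      rw [Subgroup.map_map]
      exact Subgroup.map_id M
    have h2 : (M.map (δ.prodMap (MonoidHom.id K))).map
        ((MonoidHom.snd G G).prodMap (MonoidHom.id K)) = M := by
      rw [Subgroup.map_map]
      exact Subgroup.map_id M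
    rw [mark_ofBiset_res, mark_prod, h1, h2, map_smul, smul_eq_mul, mul_comm]
    by_cases hM : mark M (idemNum F L) = 0
    · rw [hM, mul_zero, mul_zero]
    · obtain ⟨g, rfl⟩ := (mark_idemNum_ne_zero_iff M L).1 hM
      rw [mark_conj]
  rw [h] at hc
  exact (Submodule.smul_mem_iff _ hL).1 hc

theorem mem_of_forall_idemNum_mem (hG : D.Mem G) {a : FBK F K G}
    (h : ∀ L : Subgroup (G × K), mark L a ≠ 0 → idemNum F L ∈ I.eval G hG) :
    a ∈ I.eval G hG := by
  have hc : (Nat.card (G × K) : F) ≠ 0 := Nat.cast_ne_zero.2 Nat.card_pos.ne'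
  rw [← Submodule.smul_mem_iff _ hc, card_smul_eq_sum_mark]
  refine Submodule.sum_mem _ fun L _ => ?_
  by_cases hL : mark L a = 0
  · rw [hL, zero_smul]
    exact Submodule.zero_mem _
  · exact Submodule.smul_mem _ _ (h L hL)

/-- Restriction along `f` of the idempotent of the image of `L` has a nonzero mark at `L`. -/
theorem idemNum_mem_of_map (hG : D.Mem G) (hH : D.Mem H) (f : H →* G) (L : Subgroup (H × K))
    (h : idemNum F (L.map (f.prodMap (MonoidHom.id K))) ∈ I.eval G hG) :
    idemNum F L ∈ I.eval H hH := by
  refine I.idemNum_mem_of_mark_ne_zero hH (I.biset_mem hG hH (Biset.res f) _ h) ?_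
  rw [mark_ofBiset_res, mark_idemNum_ne_zero_iff]
  exact ⟨1, by rw [map_one]; exact Subgroup.map_id _⟩

/-- Apply the biset `Biset.ind f` to the idempotent of `j(L)` and take the mark at the image. The
mark is, up to nonzero factors, the number of certain pairs `(v, g)` times the constant of the
kernel `N`: all nonzero contributions are equal, so nothing cancels, and the pair `(1, 1)` is one of
them. -/
theorem idemNum_mem_of_mSum_ne_zero (hG : D.Mem G) (hH : D.Mem H) (f : H →* G) {L : Type u}
    [Group L] [Finite L] (j : L →* H × K) (hj : Function.Injective j)
    (hm : mSum F ((f.prodMap (MonoidHom.id K)).comp j).ker ≠ 0)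
    (h : idemNum F j.range ∈ I.eval H hH) :
    idemNum F ((f.prodMap (MonoidHom.id K)).comp j).range ∈ I.eval G hG := by
  set f' := f.prodMap (MonoidHom.id K)
  set M := (f'.comp j).range
  set N := (f'.comp j).ker
  refine I.idemNum_mem_of_mark_ne_zero hG (I.biset_mem hH hG (Biset.ind f) _ h) ?_
  let V := (Biset.ind f).shift K
  have key := card_mul_mark_compClass V M (idemNum F j.range)
  intro h0
  have h0' : mark M (FB.map F V.compClass (idemNum F j.range)) = 0 := h0
  rw [h0', mul_zero] at key
  let T : V.carrier → H × K → Prop := fun v g =>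
    (∀ m ∈ M, ∃ l, m • v = MulOpposite.op (g * j l * g⁻¹) • v) ∧
      ∀ l, ∃ m ∈ M, m • v = MulOpposite.op (g * j l * g⁻¹) • v
  have hact : ∀ (v : V.carrier) (h : H × K),
      MulOpposite.op h • v = (show G × K from v) * f' h := fun v h => rfl
  have hT : ∀ v g, (Nat.card L : F) * mob (V.weight F M v)
      (j.range.map (MulAut.conj g).toMonoidHom) =
      if T v g then (Nat.card N : F) * mSum F N else 0 := by
    intro v g
    rw [← MonoidHom.range_comp]
    split_ifs with h
    · refine V.card_mul_mob_weight ((MulAut.conj g).toMonoidHom.comp j)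
        ((MulAut.conj g).injective.comp hj) h.1 h.2 N fun l => ?_
      rw [hact]
      refine Iff.trans ?_ (mul_eq_left (a := (show G × K from v))).symm
      change f' (j l) = 1 ↔ f' (g * j l * g⁻¹) = 1
      rw [map_mul, map_mul, map_inv, conj_eq_one_iff]
    · by_contra hne
      obtain ⟨h1, h2⟩ := Biset.of_mob_weight_ne_zero (right_ne_zero_of_mul hne)
      refine h ⟨fun m hm => ?_, fun l => h2 _ ⟨l, rfl⟩⟩
      obtain ⟨_, ⟨l, rfl⟩, hl⟩ := h1 m hm
      exact ⟨l, hl⟩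
  -- The marks of `idemNum F j.range` turn a sum over all subgroups into a sum over the conjugates
  -- of `j(L)`, indexed by the conjugating elements.
  have hsum : ∀ c : Subgroup (H × K) → F, ∑ L' : Subgroup (H × K),
      mark L' (idemNum F j.range) * c L' =
      ∑ g : H × K, c (j.range.map (MulAut.conj g).toMonoidHom) := by
    intro c
    simp_rw [mark_idemNum, Finset.sum_mul]
    rw [Finset.sum_comm]
    refine Finset.sum_equiv (Equiv.inv _) (by simp) fun g _ => ?_
    have hiff : ∀ A B : Subgroup (H × K), A.map (MulAut.conj g).toMonoidHom = B ↔
        A = B.map (MulAut.conj g⁻¹).toMonoidHom := by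
      intro A B
      constructor
      · rintro rfl
        rw [Subgroup.map_map]
        refine (Subgroup.map_id A).symm.trans (congrArg (fun f => A.map f) ?_)
        ext x <;> simp [mul_assoc]
      · rintro rfl
        rw [Subgroup.map_map]
        refine (congrArg (fun f => B.map f) ?_).trans (Subgroup.map_id B)
        ext x <;> simp [mul_assoc]
    simp_rw [hiff]
    simp
  simp_rw [hsum] at key
  have key2 := congrArg (fun x => (Nat.card L : F) * x) key
  simp only [Finset.mul_sum, hT, mul_zero] at key2
  have hc : (Nat.card N : F) * mSum F N ≠ 0 :=
    mul_ne_zero (Nat.cast_ne_zero.2 Nat.card_pos.ne') hm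
  rw [← Finset.sum_product', ← Finset.sum_filter, Finset.sum_const, nsmul_eq_mul, eq_comm,
    mul_eq_zero, or_iff_left hc, Nat.cast_eq_zero, Finset.card_eq_zero] at key2
  refine Finset.notMem_empty ((1 : G × K), (1 : H × K)) (key2 ▸ Finset.mem_filter.2
    ⟨Finset.mem_product.2 ⟨Finset.mem_univ _, Finset.mem_univ _⟩, ?_⟩)
  have h1 : ∀ l, f' (j l) • (show V.carrier from (1 : G × K)) =
      MulOpposite.op (1 * j l * 1⁻¹) • (show V.carrier from (1 : G × K)) := by
    intro l
    rw [hact]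
    change f' (j l) * 1 = 1 * f' (1 * j l * 1⁻¹)
    simp only [mul_one, one_mul, inv_one]
  exact ⟨by rintro _ ⟨l, rfl⟩; exact ⟨l, h1 l⟩, fun l => ⟨_, ⟨l, rfl⟩, h1 l⟩⟩

end GreenIdeal

/-! ## Groups over `K` and the ideals they define -/

namespace GrpOver

variable {K : Type u} [Group K]

theorem SurjectsOnto.trans {X Y Z : GrpOver K} (h : X.SurjectsOnto Y) (h' : Y.SurjectsOnto Z) :
    X.SurjectsOnto Z := by
  obtain ⟨f, hf⟩ := h
  obtain ⟨g, hg⟩ := h'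
  exact ⟨CategoryTheory.CategoryStruct.comp (obj := GrpOver K) f g, hg.comp hf⟩

theorem SurjectsOnto.of_comp_eq {X Y : GrpOver K} (f : X.L →* Y.L) (hf : Function.Surjective f)
    (h : ∀ l, X.φ l = Y.φ (f l)) : X.SurjectsOnto Y :=
  ⟨⟨f, 1, by simpa using h⟩, hf⟩

theorem SurjectsOnto.of_iso {X Y : GrpOver K} (e : X ≅ Y) : X.SurjectsOnto Y := by
  refine ⟨e.hom, fun y => ⟨e.inv.1 y, ?_⟩⟩
  exact DFunLike.congr_fun (congrArg Subtype.val e.inv_hom_id) y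

theorem IsBKGroup.mSum_eq_zero {Y : GrpOver K} (hY : Y.IsBKGroup) (F : Type v) [Field F]
    [CharZero F] (N : Subgroup Y.L) (hN : N.Normal) (h : N ≠ ⊥) (h' : N ≤ Y.φ.ker) :
    mSum F N = 0 :=
  (mConst_eq_zero_iff F N).1 (hY N hN h h')

variable [Finite K]

/-- A subgroup of `G × K`, as a group over `K`. -/
def ofSubgroup {G : Type u} [Group G] [Finite G] (L : Subgroup (G × K)) : GrpOver K where
  L := L
  φ := (MonoidHom.snd G K).comp L.subtype

theorem surjectsOnto_map {G H : Type u} [Group G] [Finite G] [Group H] [Finite H] (f : G →* H)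
    (L : Subgroup (G × K)) :
    (ofSubgroup L).SurjectsOnto (ofSubgroup (L.map (f.prodMap (MonoidHom.id K)))) :=
  SurjectsOnto.of_comp_eq ((f.prodMap (MonoidHom.id K)).subgroupMap L)
    (MonoidHom.subgroupMap_surjective _ L) fun _ => rfl

theorem surjectsOnto_range (X : GrpOver K) {G : Type u} [Group G] [Finite G] (f : X.L →* G) :
    X.SurjectsOnto (ofSubgroup (f.prod X.φ).range) :=
  SurjectsOnto.of_comp_eq (Y := ofSubgroup (f.prod X.φ).range) (f.prod X.φ).rangeRestrict
    (MonoidHom.rangeRestrict_surjective _) fun _ => rfl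

theorem range_surjectsOnto (X : GrpOver K) {G : Type u} [Group G] [Finite G] (f : X.L →* G)
    (hf : Function.Injective (f.prod X.φ)) :
    (ofSubgroup (f.prod X.φ).range).SurjectsOnto X := by
  let e := MonoidHom.ofInjective hf
  refine SurjectsOnto.of_comp_eq (X := ofSubgroup (f.prod X.φ).range) e.symm.toMonoidHom
    e.symm.surjective fun l => ?_
  obtain ⟨x, rfl⟩ := e.surjective l
  change X.φ x = X.φ (e.symm (e x))
  rw [e.symm_apply_apply]

/-- The second coordinate of `g` changes the map to `K` by an inner automorphism, which morphisms
over `K` allow. -/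
theorem conj_surjectsOnto {G : Type u} [Group G] [Finite G] (L : Subgroup (G × K)) (g : G × K) :
    (ofSubgroup L).SurjectsOnto (ofSubgroup (L.map (MulAut.conj g).toMonoidHom)) :=
  ⟨⟨(MulAut.conj g).toMonoidHom.subgroupMap L, g.2, fun _ => rfl⟩,
    MonoidHom.subgroupMap_surjective _ L⟩

end GrpOver

theorem exists_hom_of_rel {M Y : Type*} [Group M] [Group Y] (R : M → Y → Prop)
    (total : ∀ m, ∃ y, R m y) (unique : ∀ m y y', R m y → R m y' → y = y')
    (mul : ∀ m m' y y', R m y → R m' y' → R (m * m') (y * y')) :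
    ∃ g : M →* Y, ∀ m, R m (g m) := by
  choose g hg using total
  exact ⟨MonoidHom.mk' g fun a b => unique _ _ _ (hg _) (mul _ _ _ _ (hg a) (hg b)), hg⟩

/-- Images under bisets preserve the property of having a given `B_K`-group as a quotient. -/
theorem surjectsOnto_of_mob_weight_ne_zero {F : Type v} [Field F] [CharZero F] {K : Type u}
    [Group K] [Finite K] {G H : Type u} [Group G] [Finite G] [Group H] [Finite H] (U : Biset H G)
    (M : Subgroup (H × K)) (L : Subgroup (G × K)) (v : (U.shift K).carrier)
    (h : mob ((U.shift K).weight F M v) L ≠ 0) {Y : GrpOver K} (hY : Y.IsBKGroup)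
    (hL : (GrpOver.ofSubgroup L).SurjectsOnto Y) : (GrpOver.ofSubgroup M).SurjectsOnto Y := by
  obtain ⟨⟨f, k, hk⟩, hf⟩ := hL
  change L →* Y.L at f
  change Function.Surjective f at hf
  replace hk : ∀ l : L, k * l.1.2 * k⁻¹ = Y.φ (f l) := hk
  obtain ⟨h₁, h₂⟩ := Biset.of_mob_weight_ne_zero h
  -- `N` is the stabilizer of `v` in `L`. It is normal because `L` moves `v` as elements of `M` do,
  -- and the left action of `M` commutes with the right action.
  let N : Subgroup L :=
    { carrier := {l | MulOpposite.op l.1 • v = v}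
      one_mem' := one_smul _ v
      mul_mem' := by
        intro a b (ha : MulOpposite.op a.1 • v = v) (hb : MulOpposite.op b.1 • v = v)
        change MulOpposite.op (a.1 * b.1) • v = v
        rw [MulOpposite.op_mul, mul_smul, ha, hb]
      inv_mem' := by
        intro a (ha : MulOpposite.op a.1 • v = v)
        change MulOpposite.op a.1⁻¹ • v = v
        rw [MulOpposite.op_inv, inv_smul_eq_iff, ha] }
  have hN : ∀ l : L, l ∈ N ↔ MulOpposite.op l.1 • v = v := fun l => Iff.rfl
  have hNn : N.Normal := by
    refine ⟨fun n hn x => ?_⟩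
    obtain ⟨m, -, hm⟩ := h₂ x.1 x.2
    rw [hN] at hn ⊢
    change MulOpposite.op (x.1 * n.1 * x.1⁻¹) • v = v
    rw [MulOpposite.op_mul, MulOpposite.op_mul, mul_smul, mul_smul, ← hm, ← smul_comm m, hn, hm,
      MulOpposite.op_inv, inv_smul_smul]
  have key := Biset.card_mul_mob_weight (F := F) L.subtype L.subtype_injective
    (fun m hm => (h₁ m hm).elim fun g hg => ⟨⟨g, hg.1⟩, hg.2⟩)
    (fun l => h₂ l.1 l.2) N hN
  rw [Subgroup.range_subtype] at key
  have hm : mSum F N ≠ 0 := by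
    intro h0
    rw [← mSum, h0, mul_zero, mul_eq_zero, or_iff_left h, Nat.cast_eq_zero] at key
    exact Nat.card_pos.ne' key
  -- Right multiplication on the factor `K` of `U × K` is free. So the image of `N` in `Y` lies in
  -- `Ker Y.φ`, where the `B_K` condition applies.
  have hNK : ∀ l ∈ N, l.1.2 = 1 := fun l hl => by
    have : v.2 * l.1.2 = v.2 := congrArg Prod.snd hl
    simpa using this
  obtain ⟨X, hXN, hX, hXf⟩ := exists_supplement_of_mSum_ne_zero f hf N hm fun N' h1 h2 h3 =>
    hY.mSum_eq_zero F N' h1 h2 (h3.trans (by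
      rintro _ ⟨l, hl, rfl⟩
      rw [MonoidHom.mem_ker, ← hk, hNK l hl, mul_one, mul_inv_cancel]))
  have huniq : ∀ x ∈ X, ∀ x' ∈ X, MulOpposite.op x.1 • v = MulOpposite.op x'.1 • v →
      f x = f x' := by
    intro x hx x' hx' hxx
    have h1 : x * x'⁻¹ ∈ X ⊓ N := by
      refine ⟨X.mul_mem hx (X.inv_mem hx'), ?_⟩
      change MulOpposite.op (x.1 * x'.1⁻¹) • v = v
      rw [MulOpposite.op_mul, mul_smul, hxx, MulOpposite.op_inv, inv_smul_smul]
    have h2 : f (x * x'⁻¹) ∈ (X ⊓ N).map f := ⟨_, h1, rfl⟩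
    rw [hXf, Subgroup.mem_bot, map_mul, map_inv, mul_inv_eq_one] at h2
    exact h2
  -- The element `m` is sent to `f x` for any `x ∈ X` acting on `v` as `m` does. Such an `x` exists
  -- since `XN = L`, and `f x` is unique since `f` kills `X ⊓ N`.
  have hrel : ∃ g : M →* Y.L, ∀ m : M, ∃ x ∈ X,
      m.1 • v = MulOpposite.op x.1 • v ∧ f x = g m := by
    refine exists_hom_of_rel
      (fun (m : M) y => ∃ x ∈ X, m.1 • v = MulOpposite.op x.1 • v ∧ f x = y) ?_ ?_ ?_
    · intro m
      obtain ⟨l, hl, hml⟩ := h₁ m.1 m.2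
      have h2 : (⟨l, hl⟩ : L) ∈ N ⊔ X := by
        rw [sup_comm, hXN]
        exact Subgroup.mem_top _
      obtain ⟨n, hn, x, hx, hnx⟩ := Subgroup.mem_sup_of_normal_left.1 h2
      refine ⟨f x, x, hx, ?_, rfl⟩
      have h3 : l = n.1 * x.1 := (congrArg Subtype.val hnx).symm
      rw [hml, h3, MulOpposite.op_mul, mul_smul, (hN n).1 hn]
    · rintro m _ _ ⟨x, hx, hmx, rfl⟩ ⟨x', hx', hmx', rfl⟩
      exact huniq x hx x' hx' (hmx.symm.trans hmx')
    · rintro m m' _ _ ⟨x, hx, hmx, rfl⟩ ⟨x', hx', hmx', rfl⟩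
      refine ⟨x * x', X.mul_mem hx hx', ?_, map_mul f x x'⟩
      change (m.1 * m'.1) • v = MulOpposite.op (x.1 * x'.1) • v
      rw [mul_smul, hmx', smul_comm, hmx, MulOpposite.op_mul, mul_smul]
  obtain ⟨g, hg⟩ := hrel
  -- Comparing second coordinates in `m • v = v · x` gives `x.2 = v.2⁻¹ m.2 v.2`, hence the extra
  -- conjugating factor.
  refine ⟨⟨g, k * (show K from v.2)⁻¹, fun m => ?_⟩, fun y => ?_⟩
  · obtain ⟨x, hx, hmx, hfx⟩ := hg m
    have h2 : m.1.2 * v.2 = v.2 * x.1.2 := congrArg Prod.snd hmx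
    change k * (show K from v.2)⁻¹ * m.1.2 * (k * (show K from v.2)⁻¹)⁻¹ = Y.φ (g m)
    rw [← hfx, ← hk]
    have h3 : x.1.2 = (show K from v.2)⁻¹ * (m.1.2 * (show K from v.2)) := by
      rw [eq_inv_mul_iff_mul_eq]
      exact h2.symm
    rw [h3]
    group
  · obtain ⟨x, hx, rfl⟩ : y ∈ X.map f := hX ▸ Subgroup.mem_top y
    obtain ⟨m, hm, hmx⟩ := h₂ x.1 x.2
    obtain ⟨x', hx', hmx', hfx'⟩ := hg ⟨m, hm⟩
    exact ⟨⟨m, hm⟩, hfx'.symm.trans (huniq x' hx' x hx (hmx'.symm.trans hmx))⟩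

/-- The ideal of the elements supported on subgroups having a quotient in a given set of
`B_K`-groups. -/
def surjIdeal (F : Type v) [Field F] [CharZero F] {K : Type u} [Group K] [Finite K]
    (D : GroupClass.{u}) (P : Set (GrpOver K)) (hP : ∀ Y ∈ P, Y.IsBKGroup) :
    GreenIdeal F K D where
  eval G _ _ _ :=
    { carrier := {a | ∀ L : Subgroup (G × K), mark L a ≠ 0 →
        ∃ Y ∈ P, (GrpOver.ofSubgroup L).SurjectsOnto Y}
      zero_mem' := fun L h => absurd (map_zero _) h
      add_mem' := by
        intro a b ha hb L h
        by_cases h0 : mark L a = 0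
        · refine hb L fun h1 => h ?_
          rw [map_add, h0, h1, add_zero]
        · exact ha L h0
      smul_mem' := by
        intro c a ha L h
        refine ha L fun h0 => h ?_
        rw [map_smul, h0, smul_zero] }
  biset_mem := by
    intro G H _ _ _ _ hG hH U a ha M hM
    have key := card_mul_mark_compClass (U.shift K) M a
    have hne : (Nat.card (G × K) : F) * mark M (FB.map F (U.shift K).compClass a) ≠ 0 :=
      mul_ne_zero (Nat.cast_ne_zero.2 Nat.card_pos.ne') hM
    rw [key] at hne
    obtain ⟨v, -, hv⟩ := Finset.exists_ne_zero_of_sum_ne_zero hne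
    obtain ⟨L, -, hL⟩ := Finset.exists_ne_zero_of_sum_ne_zero hv
    obtain ⟨Y, hY, hLY⟩ := ha L (left_ne_zero_of_mul hL)
    exact ⟨Y, hY, surjectsOnto_of_mob_weight_ne_zero U M L v (right_ne_zero_of_mul hL) (hP Y hY)
      hLY⟩
  prod_mem_left := by
    intro G H _ _ _ _ hG hH a b hb L hL
    rw [mark_prod] at hL
    obtain ⟨Y, hY, h⟩ := hb _ (right_ne_zero_of_mul hL)
    exact ⟨Y, hY, (GrpOver.surjectsOnto_map _ L).trans h⟩
  prod_mem_right := by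
    intro G H _ _ _ _ hG hH a b ha L hL
    rw [mark_prod] at hL
    obtain ⟨Y, hY, h⟩ := ha _ (left_ne_zero_of_mul hL)
    exact ⟨Y, hY, (GrpOver.surjectsOnto_map _ L).trans h⟩

/-! ## The subgroup `O^p` -/

section OpLemmas

variable {p : ℕ} {L L' : Type u} [Group L] [Group L']

theorem Op_le_ker [Fact p.Prime] (f : L →* L') (h : IsPGroup p L') : Op p L ≤ f.ker := by
  rw [Op, Subgroup.closure_le]
  intro x hx
  obtain ⟨k, hk⟩ := h (f x)
  rw [SetLike.mem_coe, MonoidHom.mem_ker, ← orderOf_eq_one_iff]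
  refine Nat.eq_one_of_dvd_coprimes (Nat.Coprime.pow_left k hx) (orderOf_dvd_of_pow_eq_one hk)
    (orderOf_map_dvd f x)

theorem Op_le_comap (f : L →* L') : Op p L ≤ (Op p L').comap f := by
  rw [Op, Subgroup.closure_le]
  exact fun x hx => Subgroup.subset_closure (Nat.Coprime.coprime_dvd_right (orderOf_map_dvd f x) hx)

/-- `L' / f(O^p(L))` is a quotient of the `p`-group `L / O^p(L)`, so `O^p(L')` dies in it. -/
theorem Op_le_map [Fact p.Prime] [Finite L] (f : L →* L') (hf : Function.Surjective f) :
    Op p L' ≤ (Op p L).map f := by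
  have hn : ((Op p L).map f).Normal := (Op.normal p L).map f hf
  let g : L ⧸ Op p L →* L' ⧸ (Op p L).map f :=
    QuotientGroup.map _ _ f (Subgroup.le_comap_map f _)
  have hg : Function.Surjective g := by
    rintro ⟨y⟩
    obtain ⟨x, rfl⟩ := hf y
    exact ⟨QuotientGroup.mk x, rfl⟩
  have h := Op_le_ker (QuotientGroup.mk' ((Op p L).map f))
    ((Op.isPGroup_quotient p L).of_surjective g hg)
  rwa [QuotientGroup.ker_mk'] at h

end OpLemmas

/-! ### Generated ideals, faithfulness on `O^p`, and reduction to `B_K`-groups -/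

namespace GreenIdeal

variable {F : Type v} [Field F] {K : Type u} [Group K] [Finite K] {D : GroupClass.{u}}
  {G : Type u} [Group G] [Finite G]

theorem mem_generatedBy (hG : D.Mem G) (a : FBK F K G) :
    a ∈ (generatedBy hG a).eval G hG := by
  change a ∈ ⨅ I : {I : GreenIdeal F K D | a ∈ I.eval G hG}, I.1.eval G hG
  rw [Submodule.mem_iInf]
  exact fun I => I.2

theorem generatedBy_le_iff (hG : D.Mem G) (a : FBK F K G) (I : GreenIdeal F K D) :
    generatedBy hG a ≤ I ↔ a ∈ I.eval G hG :=
  ⟨fun h => h G hG (mem_generatedBy hG a), fun h => sInf_le h⟩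

end GreenIdeal

namespace GrpOver

variable {K : Type u} [Group K] {p : ℕ}

/-- The map to `K` is injective on `O^p(L)`. -/
def OpFaithful (p : ℕ) (X : GrpOver K) : Prop := ∀ l ∈ Op p X.L, X.φ l = 1 → l = 1

theorem OpFaithful.of_surjectsOnto [Fact p.Prime] {X Y : GrpOver K} (hX : X.OpFaithful p)
    (h : X.SurjectsOnto Y) : Y.OpFaithful p := by
  obtain ⟨⟨f, k, hk⟩, hf⟩ := h
  intro y hy hy1
  obtain ⟨x, hx, rfl⟩ := Op_le_map f hf hy
  rw [← hk, conj_eq_one_iff] at hy1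
  rw [hX x hx hy1, map_one]

/-- `O^p(L)` has trivial image in the `p`-group `P`, so only the coordinate in `K` is left. -/
theorem opFaithful_ofSubgroup [Fact p.Prime] [Finite K] {P : Type u} [Group P] [Finite P]
    (hP : IsPGroup p P) (L : Subgroup (P × K)) : (ofSubgroup L).OpFaithful p := by
  intro l hl hl1
  have h := Op_le_ker ((MonoidHom.fst P K).comp L.subtype) hP hl
  exact Subtype.ext (Prod.ext h hl1)

theorem OpFaithful.injective {X : GrpOver K} (hX : X.OpFaithful p) :
    Function.Injective ((QuotientGroup.mk' (Op p X.L)).prod X.φ) := by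
  rw [injective_iff_map_eq_one]
  intro l hl
  exact hX l ((QuotientGroup.eq_one_iff l).1 (congrArg Prod.fst hl)) (congrArg Prod.snd hl)

/-- The isomorphism of groups underlying an isomorphism of groups over `K`. -/
def mulEquivOfIso {X Y : GrpOver K} (e : X ≅ Y) : X.L ≃* Y.L :=
  MonoidHom.toMulEquiv e.hom.1 e.inv.1 (congrArg Subtype.val e.hom_inv_id)
    (congrArg Subtype.val e.inv_hom_id)

theorem IsBKGroup.of_iso {X Y : GrpOver K} (hX : X.IsBKGroup) (e : X ≅ Y) : Y.IsBKGroup := by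
  intro N hN hN1 hNK
  let f := mulEquivOfIso e.symm
  obtain ⟨k, hk⟩ := e.inv.2
  rw [mConst_eq_zero_iff ℚ, ← mSum_map_equiv ℚ f]
  refine hX.mSum_eq_zero ℚ _ (hN.map _ f.surjective) ?_ ?_
  · exact fun h => hN1
      ((Subgroup.map_eq_bot_iff_of_injective N (f := f.toMonoidHom) f.injective).1 h)
  · rintro _ ⟨y, hy, rfl⟩
    have h1 : Y.φ y = 1 := hNK hy
    have h2 := hk y
    rw [h1, mul_one, mul_inv_cancel] at h2
    exact h2.symm

/-- The quotient of a group over `K` by a normal subgroup on which the map to `K` is trivial. -/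
def quotient (X : GrpOver K) (N : Subgroup X.L) [N.Normal] (hN : N ≤ X.φ.ker) : GrpOver K where
  L := X.L ⧸ N
  φ := QuotientGroup.lift N X.φ hN

theorem surjectsOnto_quotient (X : GrpOver K) (N : Subgroup X.L) [N.Normal] (hN : N ≤ X.φ.ker) :
    X.SurjectsOnto (X.quotient N hN) :=
  SurjectsOnto.of_comp_eq (Y := X.quotient N hN) (QuotientGroup.mk' N)
    (QuotientGroup.mk'_surjective N) fun _ => rfl

variable [Finite K] {F : Type v} [Field F] [CharZero F]

theorem idealP_le_iff [Fact p.Prime] (X : GrpOver K)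
    (I : GreenIdeal F K (GroupClass.pGroups.{u} p)) :
    X.idealP F p ≤ I ↔
      idemNum F (X.graphP p) ∈ I.eval (X.L ⧸ Op p X.L) (Op.isPGroup_quotient p X.L) :=
  (GreenIdeal.generatedBy_le_iff _ _ I).trans (idem_mem_iff _ _)

theorem idealP_le_of_surjectsOnto [Fact p.Prime] {X Y : GrpOver K} (h : X.SurjectsOnto Y) :
    X.idealP F p ≤ Y.idealP F p := by
  obtain ⟨⟨f, k, hk⟩, hf⟩ := h
  have hY := (Y.idealP_le_iff (F := F) (p := p) _).1 le_rfl
  rw [idealP_le_iff]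
  refine GreenIdeal.idemNum_mem_of_map _ (Op.isPGroup_quotient p Y.L) _
    (QuotientGroup.map _ _ f (Op_le_comap f)) _ ?_
  -- The induced map carries one graph to the other only up to conjugation by `(1, k)`, where `k`
  -- measures the failure of `f` to commute with the maps to `K`.
  rw [← idemNum_conj _ (1, k)]
  convert hY using 2
  rw [graphP, graphP, ← MonoidHom.range_comp, ← MonoidHom.range_comp]
  have h1 : ((MulAut.conj ((1 : Y.L ⧸ Op p Y.L), k)).toMonoidHom.comp
      (((QuotientGroup.map (Op p X.L) (Op p Y.L) f (Op_le_comap f)).prodMap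
        (MonoidHom.id K)).comp ((QuotientGroup.mk' (Op p X.L)).prod X.φ))) =
      ((QuotientGroup.mk' (Op p Y.L)).prod Y.φ).comp f := by
    ext l
    · change 1 * (QuotientGroup.mk (f l) : Y.L ⧸ Op p Y.L) * 1⁻¹ = QuotientGroup.mk (f l)
      simp
    · exact hk l
  rw [h1, MonoidHom.range_comp, MonoidHom.range_eq_top.2 hf, ← MonoidHom.range_eq_map]

theorem idealP_quotient [Fact p.Prime] {X : GrpOver K} (hX : X.OpFaithful p) (N : Subgroup X.L)
    [N.Normal] (hN : N ≤ X.φ.ker) (hm : mConst N ≠ 0) :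
    (X.quotient N hN).idealP F p = X.idealP F p := by
  refine le_antisymm ?_ (idealP_le_of_surjectsOnto (X.surjectsOnto_quotient N hN))
  have h := (X.idealP_le_iff (F := F) (p := p) _).1 le_rfl
  rw [idealP_le_iff]
  let q : X.L →* (X.quotient N hN).L := QuotientGroup.mk' N
  have hq : Function.Surjective q := QuotientGroup.mk'_surjective N
  have hφ : ∀ l, (X.quotient N hN).φ (q l) = X.φ l := fun l => rfl
  let f := QuotientGroup.map (Op p X.L) (Op p (X.quotient N hN).L) q (Op_le_comap q)
  let j := (QuotientGroup.mk' (Op p X.L)).prod X.φ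
  have h1 : (f.prodMap (MonoidHom.id K)).comp j =
      ((QuotientGroup.mk' (Op p (X.quotient N hN).L)).prod (X.quotient N hN).φ).comp q := rfl
  have h2 : ((f.prodMap (MonoidHom.id K)).comp j).range = (X.quotient N hN).graphP p := by
    rw [h1, MonoidHom.range_comp, MonoidHom.range_eq_top.2 hq, ← MonoidHom.range_eq_map]
    rfl
  -- If `l` is in the kernel, its class modulo `N` lifts to some `o ∈ O^p(L)` with `φ(o) = φ(l) =
  -- 1`; faithfulness gives `o = 1`, hence `l ∈ N`.
  have h3 : ((f.prodMap (MonoidHom.id K)).comp j).ker = N := by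
    ext l
    constructor
    · intro hl
      have hl1 : q l ∈ Op p (X.quotient N hN).L :=
        (QuotientGroup.eq_one_iff (q l)).1 (congrArg Prod.fst hl)
      have hl2 : X.φ l = 1 := congrArg Prod.snd hl
      obtain ⟨o, ho, hol⟩ := Op_le_map q hq hl1
      have ho1 : X.φ o = 1 := by rw [← hφ, hol, hφ, hl2]
      rw [hX o ho ho1, map_one] at hol
      exact (QuotientGroup.eq_one_iff l).1 hol.symm
    · intro hl
      have hl1 : q l = 1 := (QuotientGroup.eq_one_iff l).2 hl
      rw [h1, MonoidHom.mem_ker, MonoidHom.comp_apply, hl1, map_one]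
  rw [← h2]
  refine GreenIdeal.idemNum_mem_of_mSum_ne_zero _ _ _ f j hX.injective ?_ h
  rw [h3]
  exact fun h0 => hm ((mConst_eq_zero_iff F N).2 h0)

theorem exists_isBKGroup_quotient [Fact p.Prime] (F : Type v) [Field F] [CharZero F]
    (X : GrpOver K) (hX : X.OpFaithful p) :
    ∃ Y : GrpOver K, Y.IsBKGroup ∧ X.SurjectsOnto Y ∧ Y.idealP F p = X.idealP F p := by
  induction hn : Nat.card X.L using Nat.strong_induction_on generalizing X with
  | _ n ih =>
  by_cases hB : X.IsBKGroup
  · exact ⟨X, hB, SurjectsOnto.of_iso (CategoryTheory.Iso.refl X), rfl⟩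
  · unfold IsBKGroup at hB
    push Not at hB
    obtain ⟨N, hN, hN1, hNK, hm⟩ := hB
    have hlt : Nat.card (X.quotient N hNK).L < n := by
      have h1 : 1 < Nat.card N := N.one_lt_card_iff_ne_bot.2 hN1
      have h2 : 0 < Nat.card (X.L ⧸ N) := Nat.card_pos
      have h3 := N.card_eq_card_quotient_mul_card_subgroup
      change Nat.card (X.L ⧸ N) < n
      nlinarith
    have hs := X.surjectsOnto_quotient N hNK
    obtain ⟨Y, hY, hYs, hYi⟩ := ih _ hlt _ (hX.of_surjectsOnto hs) rfl
    exact ⟨Y, hY, hs.trans hYs, hYi.trans (idealP_quotient hX N hNK hm)⟩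

theorem idemNum_mem_surjIdeal {D : GroupClass.{u}} {P : Set (GrpOver K)}
    (hP : ∀ Y ∈ P, Y.IsBKGroup) {Y : GrpOver K} (hY : Y ∈ P) {G : Type u} [Group G] [Finite G]
    (hG : D.Mem G) (f : Y.L →* G) (hf : Function.Injective (f.prod Y.φ)) :
    idemNum F (f.prod Y.φ).range ∈ (surjIdeal F D P hP).eval G hG := by
  intro L hL
  obtain ⟨g, hg⟩ := (mark_idemNum_ne_zero_iff L _).1 hL
  refine ⟨Y, hY, (conj_surjectsOnto L g).trans ?_⟩
  rw [hg]
  exact Y.range_surjectsOnto f hf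

theorem mark_idemNum_self {G : Type u} [Group G] [Finite G] (L : Subgroup G) :
    mark L (idemNum F L) ≠ 0 :=
  (mark_idemNum_ne_zero_iff L L).2 ⟨1, by rw [map_one]; exact Subgroup.map_id L⟩

/-- If the ideal is nonzero at a `p`-group `P`, `surjIdeal` gives a subgroup of `P × K` surjecting
onto `X`, and faithfulness on `O^p` passes to quotients. Conversely, a faithful `X` embeds in
`L^{[p]} × K`, so the idempotent of its image is a nonzero element of the ideal at `L^{[p]}`. -/
theorem isPersistent_iff [Fact p.Prime] (F : Type v) [Field F] [CharZero F] {X : GrpOver K}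
    (hX : X.IsBKGroup) : X.IsPersistent F p ↔ X.OpFaithful p := by
  constructor
  · rintro ⟨P, _, _, hP, hne⟩
    obtain ⟨a, ha, ha0⟩ := (Submodule.ne_bot_iff _).1 hne
    have hle : X.ideal F ≤ surjIdeal F GroupClass.all {X} (by rintro _ rfl; exact hX) := by
      refine (GreenIdeal.generatedBy_le_iff (D := GroupClass.all) _ _ _).2
        ((idem_mem_iff _ _).2 ?_)
      exact idemNum_mem_surjIdeal (F := F) (D := GroupClass.all) (P := {X}) (Y := X) _ rfl trivial
        (MonoidHom.id X.L) fun x y h => congrArg Prod.fst h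
    obtain ⟨L, hL⟩ : ∃ L : Subgroup (P × K), mark L a ≠ 0 := by
      by_contra! h
      exact ha0 (ext_mark fun L => by rw [h, map_zero])
    obtain ⟨_, rfl, h⟩ := hle P trivial ha L hL
    exact (opFaithful_ofSubgroup hP L).of_surjectsOnto h
  · intro h
    refine ⟨X.L ⧸ Op p X.L, inferInstance, inferInstance, Op.isPGroup_quotient p X.L, ?_⟩
    rw [Submodule.ne_bot_iff]
    have h1 : idemNum F X.graph ∈ (X.ideal F).eval X.L trivial :=
      (idem_mem_iff _ _).1 (GreenIdeal.mem_generatedBy (D := GroupClass.all) _ _)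
    refine ⟨idemNum F (X.graphP p), ?_, fun h0 => mark_idemNum_self (F := F) (X.graphP p) ?_⟩
    · refine GreenIdeal.idemNum_mem_of_mSum_ne_zero (X.ideal F) trivial trivial
        (QuotientGroup.mk' (Op p X.L)) ((MonoidHom.id X.L).prod X.φ)
        (fun x y h => congrArg Prod.fst h) ?_ h1
      have hk : (((QuotientGroup.mk' (Op p X.L)).prodMap (MonoidHom.id K)).comp
          ((MonoidHom.id X.L).prod X.φ)).ker = ⊥ := (MonoidHom.ker_eq_bot_iff _).2 h.injective
      rw [hk, mSum_bot]
      exact Nat.cast_ne_zero.2 Nat.card_pos.ne'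
    · rw [h0, map_zero]

/-- As `G` is a `p`-group, the projection `L → G` factors through `L^{[p]}`, and the induced map
takes the graph in `L^{[p]} × K` isomorphically onto `L`. Restriction along it gives one direction,
`Biset.ind` with trivial kernel the other. -/
theorem idemNum_mem_iff [Fact p.Prime] {G : Type u} [Group G] [Finite G]
    (hG : (GroupClass.pGroups.{u} p).Mem G) (L : Subgroup (G × K))
    (I : GreenIdeal F K (GroupClass.pGroups.{u} p)) :
    idemNum F L ∈ I.eval G hG ↔ (ofSubgroup L).idealP F p ≤ I := by
  rw [idealP_le_iff]
  let X := ofSubgroup L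
  let π : X.L →* G := (MonoidHom.fst G K).comp L.subtype
  let f : X.L ⧸ Op p X.L →* G := QuotientGroup.lift _ π (Op_le_ker π hG)
  let j := (QuotientGroup.mk' (Op p X.L)).prod X.φ
  have h1 : ((f.prodMap (MonoidHom.id K)).comp j).range = L := L.range_subtype
  constructor
  · intro h
    refine I.idemNum_mem_of_map hG _ f _ ?_
    rw [graphP, ← MonoidHom.range_comp]
    exact h1.symm ▸ h
  · intro h
    have h2 := I.idemNum_mem_of_mSum_ne_zero hG _ f j (opFaithful_ofSubgroup hG L).injective
      (by
        have hk : ((f.prodMap (MonoidHom.id K)).comp j).ker = ⊥ := L.ker_subtype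
        rw [hk, mSum_bot]
        exact Nat.cast_ne_zero.2 Nat.card_pos.ne') h
    rwa [h1] at h2

end GrpOver

/-! ### Ideals and closed sets of persistent `B_K`-groups -/

section Main

variable {p : ℕ} [Fact p.Prime] {F : Type v} [Field F] [CharZero F]
  {K : Type u} [Group K] [Finite K] {S : Set (GrpOver K)}

theorem exists_mem_persistentBK (hS : IsRepresentatives S) (X : GrpOver K) (hX : X.OpFaithful p) :
    ∃ Z : persistentBK F p S, X.SurjectsOnto Z.1 ∧ Z.1.idealP F p = X.idealP F p := by
  obtain ⟨Y, hY, hs, hi⟩ := X.exists_isBKGroup_quotient F hX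
  obtain ⟨Z, ⟨hZ, ⟨e⟩⟩, -⟩ := hS Y
  have h := hs.trans (GrpOver.SurjectsOnto.of_iso e)
  have hB := hY.of_iso e
  refine ⟨⟨Z, hZ, hB, (GrpOver.isPersistent_iff F hB).2 (hX.of_surjectsOnto h)⟩, h, ?_⟩
  rw [← hi]
  exact le_antisymm (GrpOver.idealP_le_of_surjectsOnto (GrpOver.SurjectsOnto.of_iso e.symm))
    (GrpOver.idealP_le_of_surjectsOnto (GrpOver.SurjectsOnto.of_iso e))

theorem le_of_forall_idealP_le (hS : IsRepresentatives S)
    {I J : GreenIdeal F K (GroupClass.pGroups.{u} p)}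
    (h : ∀ X : persistentBK F p S, X.1.idealP F p ≤ I → X.1.idealP F p ≤ J) : I ≤ J := by
  intro G _ _ hG a ha
  refine J.mem_of_forall_idemNum_mem hG fun L hL => ?_
  have h1 := (GrpOver.idemNum_mem_iff hG L I).1 (I.idemNum_mem_of_mark_ne_zero hG ha hL)
  obtain ⟨Z, -, hZ⟩ := exists_mem_persistentBK (F := F) hS _
    (GrpOver.opFaithful_ofSubgroup hG L)
  rw [GrpOver.idemNum_mem_iff, ← hZ]
  exact h Z (hZ ▸ h1)

/-- The whole sum lies in the `surjIdeal` of `P`; testing the generator of the ideal of `X` at its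
own graph yields a quotient in `P`. -/
theorem surjectsOnto_of_idealP_le_iSup (P : Set (persistentBK F p S)) (X : persistentBK F p S)
    (h : X.1.idealP F p ≤ ⨆ Y ∈ P, Y.1.idealP F p) : ∃ Y ∈ P, X.1.SurjectsOnto Y.1 := by
  let P' : Set (GrpOver K) := Subtype.val '' P
  have hP' : ∀ Y ∈ P', Y.IsBKGroup := by
    rintro _ ⟨Y, -, rfl⟩
    exact Y.2.2.1
  have hle : ⨆ Y ∈ P, Y.1.idealP F p ≤ surjIdeal F (GroupClass.pGroups p) P' hP' := by
    refine iSup₂_le fun Y hY => ?_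
    rw [GrpOver.idealP_le_iff]
    exact GrpOver.idemNum_mem_surjIdeal hP' ⟨Y, hY, rfl⟩ _ _
      ((GrpOver.isPersistent_iff F Y.2.2.1).1 Y.2.2.2).injective
  obtain ⟨_, ⟨Y, hY, rfl⟩, hs⟩ := (X.1.idealP_le_iff _).1 (h.trans hle) (X.1.graphP p)
    (GrpOver.mark_idemNum_self _)
  exact ⟨Y, hY, (X.1.surjectsOnto_range _).trans hs⟩

/-- The isomorphism from the lattice of ideals to the lattice of closed sets of `p`-persistent
`B_K`-groups. -/
def idealsOrderIso (hS : IsRepresentatives S) :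
    GreenIdeal F K (GroupClass.pGroups.{u} p) ≃o closedSets F p S where
  toFun I := ⟨{X | X.1.idealP F p ≤ I},
    fun _ hX _ hs => (GrpOver.idealP_le_of_surjectsOnto hs).trans hX⟩
  invFun P := ⨆ X ∈ (P : Set (persistentBK F p S)), X.1.idealP F p
  left_inv I := by
    refine le_antisymm (iSup₂_le fun X hX => hX) (le_of_forall_idealP_le hS fun X hX => ?_)
    exact le_iSup₂_of_le (f := fun (X : persistentBK F p S) _ => X.1.idealP F p) X hX le_rfl
  right_inv P := by
    refine Subtype.ext (Set.ext fun X => ⟨fun hX => ?_, fun hX => ?_⟩)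
    · obtain ⟨Y, hY, hs⟩ := surjectsOnto_of_idealP_le_iSup P.1 X hX
      exact P.2 Y hY X hs
    · exact le_iSup₂_of_le (f := fun (X : persistentBK F p S) _ => X.1.idealP F p) X hX le_rfl
  map_rel_iff' := ⟨fun h => le_of_forall_idealP_le hS fun _ hX => h hX,
    fun h _ hX => le_trans hX h⟩

end Main

/-- In a complete sublattice of a power set, joins and meets are unions and intersections, so the
law is that of sets. -/
theorem iInf_iSup_eq_of_orderIso {α X : Type*} [CompleteLattice α]
    {T : CompleteSublattice (Set X)} (Φ : α ≃o T) {ι : Type w} {κ : ι → Type w}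
    (f : ∀ i, κ i → α) : ⨅ i, ⨆ j, f i j = ⨆ g : ∀ i, κ i, ⨅ i, f i (g i) := by
  refine Φ.injective (Subtype.ext ?_)
  simp only [map_iInf, map_iSup, CompleteSublattice.coe_iInf, CompleteSublattice.coe_iSup]
  exact iInf_iSup_eq

theorem iSup_iInf_eq_of_orderIso {α X : Type*} [CompleteLattice α]
    {T : CompleteSublattice (Set X)} (Φ : α ≃o T) {ι : Type w} {κ : ι → Type w}
    (f : ∀ i, κ i → α) : ⨆ i, ⨅ j, f i j = ⨅ g : ∀ i, κ i, ⨆ i, f i (g i) := by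
  refine Φ.injective (Subtype.ext ?_)
  simp only [map_iInf, map_iSup, CompleteSublattice.coe_iInf, CompleteSublattice.coe_iSup]
  exact iSup_iInf_eq

end

end RelB


open RelB
theorem mainTheorem8 (p : ℕ) [Fact p.Prime] (F : Type v) [Field F] [CharZero F]
    (K : Type u) [Group K] [Finite K] (S : Set (GrpOver K)) (hS : IsRepresentatives S) :
    (∃ Φ : GreenIdeal F K (GroupClass.pGroups p) ≃o closedSets F p S,
      (∀ I : GreenIdeal F K (GroupClass.pGroups p),
        (Φ I : Set (persistentBK F p S)) = {X | X.1.idealP F p ≤ I}) ∧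
      (∀ P : closedSets F p S,
        Φ.symm P = ⨆ X ∈ (P : Set (persistentBK F p S)), X.1.idealP F p)) ∧
    (∀ (ι : Type w) (κ : ι → Type w)
      (f : ∀ i, κ i → GreenIdeal F K (GroupClass.pGroups p)),
      ⨅ i, ⨆ j, f i j = ⨆ g : ∀ i, κ i, ⨅ i, f i (g i)) ∧
    (∀ (ι : Type w) (κ : ι → Type w)
      (f : ∀ i, κ i → GreenIdeal F K (GroupClass.pGroups p)),
      ⨆ i, ⨅ j, f i j = ⨅ g : ∀ i, κ i, ⨆ i, f i (g i)) :=
  ⟨⟨idealsOrderIso hS, fun _ => rfl, fun _ => rfl⟩,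
    fun _ _ f => iInf_iSup_eq_of_orderIso (idealsOrderIso hS) f,
    fun _ _ f => iSup_iInf_eq_of_orderIso (idealsOrderIso hS) f⟩
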